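/- Let $\mathcal X\subseteq\mathbb R^m$ and let $\rho:\mathbb R^m\to[0,\infty)$ be a bounded probability density with $\rho>0$ on $\mathcal X$ and $\rho=0$ off $\mathcal X$. Assume that $\mathcal X$ is convex and that there are constants $a,b,c>0$ and a function $V$ on $\mathcal X$ such that $V(\mathbf x)-\tfrac c2|\mathbf x|^2$ is convex on $\mathcal X$ and $a\,e^{-V}\le\rho\le b\,e^{-V}$ on $\mathcal X$. (This includes the standard Gaussian density on $\mathbb R^m$, the uniform density on a hypercube, and every density that is bounded away from zero on a bounded convex set.) Then there is a constant $C_1\ge 0$, depending only on $\mathcal X$ and $\rho$, with the following property. Let $1\le n<m$. Let $f$ be absolutely continuous on $\mathcal X$ (on almost every line parallel to a coordinate axis, $f$ is absolutely continuous on every compact interval contained in $\mathcal X$), square-integrable with respect to $\rho$, with partial derivatives square-integrable with respect to $\rho$. Let $\mathbf C=\mathbb E[(\nabla f)(\nabla f)^T]=\mathbf W\Lambda\mathbf W^T$ with $\mathbf W$ orthogonal and $\Lambda=\mathrm{diag}(\lambda_1,\dots,\lambda_m)$, $\lambda_1\ge\cdots\ge\lambda_m\ge 0$, where $\mathbf x$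 has density $\rho$. Let $\mathbf W_1$ and $\mathbf W_2$ be the first $n$ and the last $m-n$ columns of $\mathbf W$, $\mathbf y=\mathbf W_1^T\mathbf x$, $\mathbf z=\mathbf W_2^T\mathbf x$, with joint density $\pi(\mathbf y,\mathbf z)=\rho(\mathbf W_1\mathbf y+\mathbf W_2\mathbf z)$, marginals $\pi_Y,\pi_Z$ and conditional densities $\pi_{Z|Y},\pi_{Y|Z}$. Let $F(\mathbf x)=G(\mathbf W_1^T\mathbf x)$ with $G(\mathbf y)=\mathbb E[f\mid\mathbf y]=\int f(\mathbf W_1\mathbf y+\mathbf W_2\mathbf z)\,\pi_{Z|Y}(\mathbf z|\mathbf y)\,d\mathbf z$. Then $$\mathbb E[(f-F)^2]\le C_1(\lambda_{n+1}+\cdots+\lambda_m).$$ Moreover, let $N\ge1$ and let $\hat F(\mathbf x)=\hat G(\mathbf W_1^T\mathbf x)$, where $\hat G(\mathbf y)=\frac1N\sum_{i=1}^N f(\mathbf W_1\mathbf y+\mathbf W_2\mathbf z_i)$ with $\mathbf z_1,\dots,\mathbf z_N$ drawn independently from $\pi_{Z|Y}(\cdot|\mathbf y)$; the draws made for the evaluations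 of $\hat G$ at different points are independent of each other, and, given $\mathbf y=\mathbf W_1^T\mathbf x$, of $\mathbf x$. Let $\mathbf y_1,\dots,\mathbf y_P\in\{\mathbf W_1^T\mathbf x:\mathbf x\in\mathcal X\}$ be design points with $\pi_Y(\mathbf y_k)>0$, let $\mathcal R$ be a measurable function, and let $\tilde F(\mathbf x)=\tilde G(\mathbf W_1^T\mathbf x)$ with $\tilde G(\mathbf y)=\mathcal R(\mathbf y;\hat G(\mathbf y_1),\dots,\hat G(\mathbf y_P))$. Suppose that $C_2,\delta\ge0$ satisfy $$\mathbb E[(\hat F-\tilde F)^2\mid\mathbf z]\le C_2\,\delta\qquad\text{for all }\mathbf z\in\mathcal Z=\{\mathbf W_2^T\mathbf x:\mathbf x\in\mathcal X\}.$$ Then $$\mathbb E[(f-\tilde F)^2]\le C_1\Big(1+\frac1N\Big)(\lambda_{n+1}+\cdots+\lambda_m)+C_2\,\delta .$$ Here the expectations are over $\mathbf x$ and over all Monte Carlo draws. -/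

import Mathlib

open MeasureTheory
open scoped ENNReal

noncomputable section

namespace ActiveSubspace

/-- `ρ` is a bounded probability density on `ℝᵐ`, positive on `X` and zero off `X`. -/
structure IsInputDensity {m : ℕ} (X : Set (Fin m → ℝ)) (ρ : (Fin m → ℝ) → ℝ) : Prop where
  measurable : Measurable ρ
  bounded : ∃ B : ℝ, ∀ x, ρ x ≤ B
  pos : ∀ x ∈ X, 0 < ρ x
  zero : ∀ x, x ∉ X → ρ x = 0
  total : ∫⁻ x, ENNReal.ofReal (ρ x) = 1

/-- `X` is convex and, on `X`, the density `ρ` lies between two positive multiples of `exp (-V)`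
for a function `V` that is strongly convex on `X` (`V - (c/2)|x|²` is convex for some `c > 0`,
with the Euclidean `|x|`). The standard Gaussian on `ℝᵐ`, the uniform density on a hypercube,
and every density bounded away from zero on a bounded convex set are of this kind. -/
def StronglyLogConcaveType {m : ℕ} (X : Set (Fin m → ℝ)) (ρ : (Fin m → ℝ) → ℝ) : Prop :=
  Convex ℝ X ∧
    ∃ (V : (Fin m → ℝ) → ℝ) (a b c : ℝ), 0 < a ∧ 0 < b ∧ 0 < c ∧
      ConvexOn ℝ X (fun x => V x - c / 2 * ∑ i, x i ^ 2) ∧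
      ∀ x ∈ X, a * Real.exp (-V x) ≤ ρ x ∧ ρ x ≤ b * Real.exp (-V x)

/-- The probability measure with density `ρ`. -/
def inputMeasure {m : ℕ} (ρ : (Fin m → ℝ) → ℝ) : Measure (Fin m → ℝ) :=
  volume.withDensity fun x => ENNReal.ofReal (ρ x)

/-- Absolute continuity of a function of several variables on `X`: on almost every line parallel
to a coordinate axis, `f` is absolutely continuous on every compact interval contained in `X`. -/
def AbsContOn {m : ℕ} (X : Set (Fin m → ℝ)) (f : (Fin m → ℝ) → ℝ) : Prop :=
  ∀ i : Fin m, ∀ᵐ x : Fin m → ℝ, ∀ s t : ℝ,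
    (∀ r ∈ Set.uIcc s t, Function.update x i r ∈ X) →
      AbsolutelyContinuousOnInterval (fun r => f (Function.update x i r)) s t

/-- The partial derivative `∂f/∂xᵢ`. -/
def pderiv {m : ℕ} (f : (Fin m → ℝ) → ℝ) (i : Fin m) (x : Fin m → ℝ) : ℝ :=
  lineDeriv ℝ f x (Pi.single i 1)

/-- The matrix `C = E[(∇f)(∇f)ᵀ]`. -/
def gradCov {m : ℕ} (ρ f : (Fin m → ℝ) → ℝ) : Matrix (Fin m) (Fin m) ℝ :=
  Matrix.of fun i j => ∫ x, pderiv f i x * pderiv f j x ∂(inputMeasure ρ)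

/-- Indices of the first `n` coordinates. -/
abbrev Act (m n : ℕ) : Type := {i : Fin m // (i : ℕ) < n}

/-- Indices of the last `m - n` coordinates. -/
abbrev Inact (m n : ℕ) : Type := {i : Fin m // ¬ (i : ℕ) < n}

/-- The first `n` columns of `W`. -/
def W₁ {m : ℕ} (n : ℕ) (W : Matrix (Fin m) (Fin m) ℝ) : Matrix (Fin m) (Act m n) ℝ :=
  W.submatrix id Subtype.val

/-- The last `m - n` columns of `W`. -/
def W₂ {m : ℕ} (n : ℕ) (W : Matrix (Fin m) (Fin m) ℝ) : Matrix (Fin m) (Inact m n) ℝ :=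
  W.submatrix id Subtype.val

/-- The coordinates `y = W₁ᵀ x`. -/
def yCoord {m : ℕ} (n : ℕ) (W : Matrix (Fin m) (Fin m) ℝ) (x : Fin m → ℝ) : Act m n → ℝ :=
  (W₁ n W).transpose.mulVec x

/-- The coordinates `z = W₂ᵀ x`. -/
def zCoord {m : ℕ} (n : ℕ) (W : Matrix (Fin m) (Fin m) ℝ) (x : Fin m → ℝ) : Inact m n → ℝ :=
  (W₂ n W).transpose.mulVec x

/-- The point `W₁ y + W₂ z`. -/
def recombine {m n : ℕ} (W : Matrix (Fin m) (Fin m) ℝ)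
    (y : Act m n → ℝ) (z : Inact m n → ℝ) : Fin m → ℝ :=
  (W₁ n W).mulVec y + (W₂ n W).mulVec z

/-- The joint density `π(y, z) = ρ(W₁ y + W₂ z)`. -/
def jointDensity {m n : ℕ} (ρ : (Fin m → ℝ) → ℝ) (W : Matrix (Fin m) (Fin m) ℝ)
    (y : Act m n → ℝ) (z : Inact m n → ℝ) : ℝ≥0∞ :=
  ENNReal.ofReal (ρ (recombine W y z))

/-- The marginal density of `y`. -/
def densityY {m n : ℕ} (ρ : (Fin m → ℝ) → ℝ) (W : Matrix (Fin m) (Fin m) ℝ)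
    (y : Act m n → ℝ) : ℝ≥0∞ :=
  ∫⁻ z : Inact m n → ℝ, jointDensity ρ W y z

/-- The marginal density of `z`. -/
def densityZ {m n : ℕ} (ρ : (Fin m → ℝ) → ℝ) (W : Matrix (Fin m) (Fin m) ℝ)
    (z : Inact m n → ℝ) : ℝ≥0∞ :=
  ∫⁻ y : Act m n → ℝ, jointDensity ρ W y z

/-- The conditional law of `z` given `y`, with density `π(y, z) / π_Y(y)`. -/
def condZ {m n : ℕ} (ρ : (Fin m → ℝ) → ℝ) (W : Matrix (Fin m) (Fin m) ℝ)
    (y : Act m n → ℝ) : Measure (Inact m n → ℝ) :=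
  volume.withDensity fun z => jointDensity ρ W y z / densityY ρ W y

/-- The conditional law of `y` given `z`, with density `π(y, z) / π_Z(z)`. -/
def condY {m n : ℕ} (ρ : (Fin m → ℝ) → ℝ) (W : Matrix (Fin m) (Fin m) ℝ)
    (z : Inact m n → ℝ) : Measure (Act m n → ℝ) :=
  volume.withDensity fun y => jointDensity ρ W y z / densityZ ρ W z

/-- The conditional expectation `G(y) = E[f | y]`. -/
def condMean {m n : ℕ} (ρ f : (Fin m → ℝ) → ℝ) (W : Matrix (Fin m) (Fin m) ℝ)
    (y : Act m n → ℝ) : ℝ :=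
  ∫ z, f (recombine W y z) ∂(condZ ρ W y)

/-- The Monte Carlo estimate `Ĝ(y) = (1/N) ∑ᵢ f(W₁ y + W₂ zᵢ)` computed from the draws `zᵢ`. -/
def mcEstimate {m n N : ℕ} (f : (Fin m → ℝ) → ℝ) (W : Matrix (Fin m) (Fin m) ℝ)
    (y : Act m n → ℝ) (zs : Fin N → Inact m n → ℝ) : ℝ :=
  (1 / (N : ℝ)) * ∑ i, f (recombine W y (zs i))

/-- The law of `N` independent draws from the conditional density of `z` given `y`. -/
def mcLaw {m n : ℕ} (N : ℕ) (ρ : (Fin m → ℝ) → ℝ) (W : Matrix (Fin m) (Fin m) ℝ)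
    (y : Act m n → ℝ) : Measure (Fin N → Inact m n → ℝ) :=
  Measure.pi fun _ => condZ ρ W y

/-- The law of all the draws behind the training data: independently at each design point `d k`,
`N` independent draws from the conditional density of `z` given `y = d k`. -/
def trainLaw {m n P : ℕ} (N : ℕ) (ρ : (Fin m → ℝ) → ℝ) (W : Matrix (Fin m) (Fin m) ℝ)
    (d : Fin P → Act m n → ℝ) : Measure (Fin P → Fin N → Inact m n → ℝ) :=
  Measure.pi fun k => mcLaw N ρ W (d k)

/-- The response surface `G̃(y) = R(y; Ĝ₁, …, Ĝ_P)` trained on `Ĝₖ = Ĝ(d k)`, as a function of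
the training draws `ζ`. -/
def respSurf {m n N P : ℕ} (f : (Fin m → ℝ) → ℝ) (W : Matrix (Fin m) (Fin m) ℝ)
    (d : Fin P → Act m n → ℝ) (R : (Act m n → ℝ) → (Fin P → ℝ) → ℝ)
    (ζ : Fin P → Fin N → Inact m n → ℝ) (y : Act m n → ℝ) : ℝ :=
  R y fun k => mcEstimate f W (d k) (ζ k)

/-- `E[(f - F)²]` with `F(x) = G(W₁ᵀ x)`. -/
def mseCondMean {m : ℕ} (n : ℕ) (ρ f : (Fin m → ℝ) → ℝ) (W : Matrix (Fin m) (Fin m) ℝ) : ℝ≥0∞ :=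
  ∫⁻ x, ENNReal.ofReal ((f x - condMean ρ f W (yCoord n W x)) ^ 2) ∂(inputMeasure ρ)

/-- `E[(f - F̃)²]` with `F̃(x) = G̃(W₁ᵀ x)`; the expectation is over `x` and, independently, over
the training draws. -/
def mseRespSurf {m n P : ℕ} (N : ℕ) (ρ f : (Fin m → ℝ) → ℝ) (W : Matrix (Fin m) (Fin m) ℝ)
    (d : Fin P → Act m n → ℝ) (R : (Act m n → ℝ) → (Fin P → ℝ) → ℝ) : ℝ≥0∞ :=
  ∫⁻ ζ, ∫⁻ x, ENNReal.ofReal ((f x - respSurf f W d R ζ (yCoord n W x)) ^ 2)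
    ∂(inputMeasure ρ) ∂(trainLaw N ρ W d)

/-- `E[(F̂ - F̃)² | z]`: `y` follows its conditional law given `z`, the `N` draws behind `F̂` are
independent draws from the conditional density of `z` given that `y`, and the training draws
behind `F̃` are independent of all this. -/
def condErrRespSurf {m n P : ℕ} (N : ℕ) (ρ f : (Fin m → ℝ) → ℝ) (W : Matrix (Fin m) (Fin m) ℝ)
    (d : Fin P → Act m n → ℝ) (R : (Act m n → ℝ) → (Fin P → ℝ) → ℝ)
    (z : Inact m n → ℝ) : ℝ≥0∞ :=
  ∫⁻ y, ∫⁻ ζ, ∫⁻ zs, ENNReal.ofReal ((mcEstimate f W y zs - respSurf f W d R ζ y) ^ 2)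
    ∂(mcLaw N ρ W y) ∂(trainLaw N ρ W d) ∂(condY ρ W z)

end ActiveSubspace

end

noncomputable section

namespace ActiveSubspace

/-! In the coordinates `x = W₁ y + W₂ z` the error `E[(f - F)²]` is the conditional variance of `f`
given `y`, averaged over `y`. A Poincaré inequality on the slices of fixed `y`, with a constant
independent of `y`, `W` and `n`, bounds it by the mean square of the gradient along the slices. That
gradient is `W₂ᵀ∇f`, and its mean square is the trace of `W₂ᵀ C W₂`, the sum of the last
eigenvalues.

The Poincaré inequality is proved by transport along segments. By Jensen, the variance is at most
the double integral of `(f(x + v) - f(x))²` against `ρ(x) ρ(x + v)`, and the increment is the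
integral of `∇f · v` along the segment. Strong convexity of `V` bounds `V(x) + V(x + v)` from below
by the value of `V` at an intermediate point, plus its value at a second, partner point of the
segment, plus a gain proportional to `|v|²`. The exponential of the gain absorbs the factor `|v|²`
coming from `∇f · v`, and `ρ(x) ρ(x + v)` is replaced by a product of densities at the two inner
points (`exists_density_endpoints_le`). These stay apart by a fixed fraction of `v`, so a linear
change of variables separates the integrals (`lintegral_sq_sub_le`). The comparison concerns
arbitrary segments of `ℝᵐ`, hence every slice inherits it with the same constant.

Since `f` is absolutely continuous only on lines parallel to the axes, while the segments are
oblique, the partial derivatives are first shown to be weak derivatives; these can be integrated in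
any direction, along almost every segment (`ae_sub_eq_integral_of_weak_deriv`).

For the response surface, fix the training draws. Then `F̃` is a function of `y`, so `E[(f - F̃)²]`
splits orthogonally into `E[(f - F)²]` and `E[(F - F̃)²]`. Given `y`, the estimate `F̂` from fresh
draws has mean `F`, so Jensen bounds the second term by `E[(F̂ - F̃)²]`, which the hypothesis
controls after averaging over `z`. This gives the bound even without the term in `1/N`. -/

/-! ### Comparison of densities along a segment. -/

/-- The cubic `s²(3 - 2 * s)`, which maps `[0, 1]` onto itself with vanishing slope at both ends. -/
def smoothstep (s : ℝ) : ℝ := s ^ 2 * (3 - 2 * s)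

lemma smoothstep_mem {s : ℝ} (hs : s ∈ Set.Icc (0 : ℝ) 1) : smoothstep s ∈ Set.Icc (0 : ℝ) 1 := by
  obtain ⟨h0, h1⟩ := hs
  unfold smoothstep
  constructor
  · have : 0 ≤ 3 - 2 * s := by linarith
    positivity
  · nlinarith [mul_nonneg (sq_nonneg (1 - s)) (by linarith : (0 : ℝ) ≤ 1 + 2 * s)]

lemma hasDerivAt_smoothstep (s : ℝ) : HasDerivAt smoothstep (6 * s * (1 - s)) s := by
  have h := ((hasDerivAt_id s).pow 2).mul (((hasDerivAt_id s).const_mul 2).const_sub 3)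
  refine (h.congr_deriv ?_)
  simp
  ring

lemma continuous_smoothstep : Continuous smoothstep := by
  unfold smoothstep; fun_prop

/-- This is the purpose of the reparametrisation. The gain from strong convexity at the parameter
`t` carries the factor `t (1 - t)`, which vanishes at the ends; the squared speed vanishes there at
least as fast. The difference of the two sides is `48 (s (1 - s))³`. -/
lemma smoothstep_slope_sq_le {s : ℝ} (hs : s ∈ Set.Icc (0 : ℝ) 1) :
    (6 * s * (1 - s)) ^ 2 ≤ 12 * (smoothstep s * (1 - smoothstep s)) := by
  obtain ⟨h0, h1⟩ := hs
  have h : 12 * (smoothstep s * (1 - smoothstep s)) - (6 * s * (1 - s)) ^ 2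
      = 48 * (s * (1 - s)) ^ 2 * (s * (1 - s)) := by
    unfold smoothstep; ring
  have : 0 ≤ 48 * (s * (1 - s)) ^ 2 * (s * (1 - s)) := by
    have : 0 ≤ s * (1 - s) := mul_nonneg h0 (by linarith)
    positivity
  linarith

/-- A parameter away from `t` at which a convex function on `[0, 1]` is controlled. -/
def partnerLeft (t : ℝ) : ℝ := if 1 / 3 ≤ t ∧ t ≤ 2 / 3 then t / 2 else 1 - t

/-- The second parameter away from `t`, complementing `partnerLeft`. -/
def partnerRight (t : ℝ) : ℝ := if 1 / 3 ≤ t ∧ t ≤ 2 / 3 then (1 + t) / 2 else 1 - t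

lemma measurable_partnerLeft : Measurable partnerLeft := by
  unfold partnerLeft
  exact Measurable.ite (measurableSet_Icc (a := (1 / 3 : ℝ)) (b := 2 / 3)) (by fun_prop)
    (by fun_prop)

lemma measurable_partnerRight : Measurable partnerRight := by
  unfold partnerRight
  exact Measurable.ite (measurableSet_Icc (a := (1 / 3 : ℝ)) (b := 2 / 3)) (by fun_prop)
    (by fun_prop)

lemma partnerLeft_mem {t : ℝ} (ht : t ∈ Set.Icc (0 : ℝ) 1) :
    partnerLeft t ∈ Set.Icc (0 : ℝ) 1 := by
  obtain ⟨h0, h1⟩ := ht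
  unfold partnerLeft
  split_ifs <;> constructor <;> linarith

lemma partnerRight_mem {t : ℝ} (ht : t ∈ Set.Icc (0 : ℝ) 1) :
    partnerRight t ∈ Set.Icc (0 : ℝ) 1 := by
  obtain ⟨h0, h1⟩ := ht
  unfold partnerRight
  split_ifs <;> constructor <;> linarith

/-- The separation keeps the Jacobian of the later change of variables bounded. The reflection `1 -
t` alone would collide with `t` at `1/2`, hence the other choice on the middle third. -/
lemma abs_partnerLeft_sub {t : ℝ} (ht : t ∈ Set.Icc (0 : ℝ) 1) :
    1 / 6 ≤ |partnerLeft t - t| := by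
  obtain ⟨h0, h1⟩ := ht
  unfold partnerLeft
  split_ifs with h
  · rw [abs_of_nonpos] <;> linarith [h.1]
  · rcases not_and_or.1 h with h | h
    · rw [abs_of_nonneg] <;> linarith
    · rw [abs_of_nonpos] <;> linarith

lemma abs_partnerRight_sub {t : ℝ} (ht : t ∈ Set.Icc (0 : ℝ) 1) :
    1 / 6 ≤ |partnerRight t - t| := by
  obtain ⟨h0, h1⟩ := ht
  unfold partnerRight
  split_ifs with h
  · rw [abs_of_nonneg] <;> linarith [h.2]
  · rcases not_and_or.1 h with h | h
    · rw [abs_of_nonneg] <;> linarith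
    · rw [abs_of_nonpos] <;> linarith

/-- A function on `[0, 1]` that is strongly convex with modulus `μ` dominates, through its
endpoint values, its value at `t` together with its value at one of the two partners of `t`. -/
lemma partner_le_endpoints {g : ℝ → ℝ} {μ : ℝ} (hμ : 0 ≤ μ)
    (hg : ∀ p ∈ Set.Icc (0 : ℝ) 1, ∀ q ∈ Set.Icc (0 : ℝ) 1, ∀ l ∈ Set.Icc (0 : ℝ) 1,
      g (p + l * (q - p)) ≤ (1 - l) * g p + l * g q - μ / 2 * (l * (1 - l)) * (q - p) ^ 2)
    {t : ℝ} (ht : t ∈ Set.Icc (0 : ℝ) 1) :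
    g t + g (partnerLeft t) + μ / 2 * (t * (1 - t)) ≤ g 0 + g 1 ∨
      g t + g (partnerRight t) + μ / 2 * (t * (1 - t)) ≤ g 0 + g 1 := by
  have ht' := ht
  obtain ⟨h0, h1⟩ := ht
  have m0 : (0 : ℝ) ∈ Set.Icc (0 : ℝ) 1 := by simp
  have m1 : (1 : ℝ) ∈ Set.Icc (0 : ℝ) 1 := by simp
  have mh : (1 / 2 : ℝ) ∈ Set.Icc (0 : ℝ) 1 := by constructor <;> norm_num
  have a1 := hg 0 m0 1 m1 t ht'
  have a2 := hg 0 m0 1 m1 (1 - t) ⟨by linarith, by linarith⟩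
  have a3 := hg 0 m0 t ht' (1 / 2) mh
  have a4 := hg t ht' 1 m1 (1 / 2) mh
  have e1 : (0 : ℝ) + t * (1 - 0) = t := by ring
  have e2 : (0 : ℝ) + (1 - t) * (1 - 0) = 1 - t := by ring
  have e3 : (0 : ℝ) + 1 / 2 * (t - 0) = t / 2 := by ring
  have e4 : t + 1 / 2 * (1 - t) = (1 + t) / 2 := by ring
  rw [e1] at a1; rw [e2] at a2; rw [e3] at a3; rw [e4] at a4
  have hmt : 0 ≤ μ * (t * (1 - t)) := mul_nonneg hμ (mul_nonneg h0 (by linarith))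
  have hm2 : 0 ≤ μ * t ^ 2 := by positivity
  have hm3 : 0 ≤ μ * (1 - t) ^ 2 := by positivity
  unfold partnerLeft partnerRight
  split_ifs with h
  -- On the middle third, pair `t` with the midpoint between `t` and the endpoint where `g` is
  -- smaller. Convexity leaves a multiple of `g 0 - g 1`, whose coefficient has the right sign
  -- because `1/3 ≤ t ≤ 2/3`.
  · rcases le_total (g 0) (g 1) with hle | hle
    · left
      nlinarith [mul_nonneg (sub_nonneg.2 hle) (by linarith [h.2] : 0 ≤ 1 - 3 / 2 * t)]
    · right
      nlinarith [mul_nonneg (sub_nonneg.2 hle) (by linarith [h.1] : 0 ≤ 3 / 2 * t - 1 / 2)]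
  · left
    nlinarith

lemma strongConvexOn_segment {m : ℕ} {X : Set (Fin m → ℝ)} {V : (Fin m → ℝ) → ℝ} {c : ℝ}
    (hV : ConvexOn ℝ X (fun x => V x - c / 2 * ∑ i, x i ^ 2)) {x y : Fin m → ℝ}
    (hx : x ∈ X) (hy : y ∈ X) {l : ℝ} (hl : l ∈ Set.Icc (0 : ℝ) 1) :
    V (x + l • (y - x)) ≤
      (1 - l) * V x + l * V y - c / 2 * (l * (1 - l)) * ∑ i, (y i - x i) ^ 2 := by
  have h := hV.2 hx hy (sub_nonneg.2 hl.2) hl.1 (by ring)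
  have e : (1 - l) • x + l • y = x + l • (y - x) := by
    ext i; simp; ring
  rw [e] at h
  simp only [smul_eq_mul] at h
  have q : ∑ i, (x + l • (y - x)) i ^ 2
      = (1 - l) * ∑ i, x i ^ 2 + l * ∑ i, y i ^ 2 - l * (1 - l) * ∑ i, (y i - x i) ^ 2 := by
    simp only [Finset.mul_sum, ← Finset.sum_add_distrib, ← Finset.sum_sub_distrib]
    refine Finset.sum_congr rfl fun i _ => ?_
    simp; ring
  rw [q] at h
  nlinarith

lemma IsInputDensity.nonneg {m : ℕ} {X : Set (Fin m → ℝ)} {ρ : (Fin m → ℝ) → ℝ}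
    (hρ : IsInputDensity X ρ) (x : Fin m → ℝ) : 0 ≤ ρ x := by
  by_cases h : x ∈ X
  · exact (hρ.pos x h).le
  · rw [hρ.zero x h]

/-- The density at the ends of a segment is controlled by the density at an intermediate point
together with the density at a partner point. -/
lemma exists_density_endpoints_le {m : ℕ} {X : Set (Fin m → ℝ)} {ρ : (Fin m → ℝ) → ℝ}
    (hρ : IsInputDensity X ρ) (hXρ : StronglyLogConcaveType X ρ) :
    ∃ K : ℝ, 0 ≤ K ∧ ∀ (x v : Fin m → ℝ), ∀ s ∈ Set.Icc (0 : ℝ) 1,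
      (6 * s * (1 - s)) ^ 2 * (∑ i, v i ^ 2) * (ρ x * ρ (x + v)) ≤
        K * (ρ (x + smoothstep s • v) *
          (ρ (x + partnerLeft (smoothstep s) • v) + ρ (x + partnerRight (smoothstep s) • v))) := by
  obtain ⟨hX, V, a, b, c, ha, hb, hc, hV, hab⟩ := hXρ
  have hnn := hρ.nonneg
  -- `b²` bounds the two end densities from above, `a²` the two inner ones from below, and `24 / c`
  -- converts slope squared times `|v|²` into the convexity gain `u`.
  refine ⟨24 * b ^ 2 / (a ^ 2 * c), by positivity, fun x v s hs => ?_⟩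
  have hKn : 0 ≤ 24 * b ^ 2 / (a ^ 2 * c) := by positivity
  by_cases hx : x ∈ X
  swap
  · rw [hρ.zero x hx]
    simp only [zero_mul, mul_zero]
    have := hnn (x + smoothstep s • v)
    have := hnn (x + partnerLeft (smoothstep s) • v)
    have := hnn (x + partnerRight (smoothstep s) • v)
    positivity
  by_cases hy : x + v ∈ X
  swap
  · rw [hρ.zero _ hy]
    simp only [mul_zero]
    have := hnn (x + smoothstep s • v)
    have := hnn (x + partnerLeft (smoothstep s) • v)
    have := hnn (x + partnerRight (smoothstep s) • v)
    positivity
  have hmem : ∀ r ∈ Set.Icc (0 : ℝ) 1, x + r • v ∈ X := fun r hr => by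
    have := hX hx hy (sub_nonneg.2 hr.2) hr.1 (by ring)
    convert this using 1
    ext i; simp; ring
  set S := ∑ i, v i ^ 2 with hS
  have hS0 : 0 ≤ S := Finset.sum_nonneg fun i _ => sq_nonneg _
  set t := smoothstep s with ht
  have htm : t ∈ Set.Icc (0 : ℝ) 1 := smoothstep_mem hs
  have hg : ∀ p ∈ Set.Icc (0 : ℝ) 1, ∀ q ∈ Set.Icc (0 : ℝ) 1, ∀ l ∈ Set.Icc (0 : ℝ) 1,
      V (x + (p + l * (q - p)) • v) ≤ (1 - l) * V (x + p • v) + l * V (x + q • v)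
        - (c * S) / 2 * (l * (1 - l)) * (q - p) ^ 2 := fun p hp q hq l hl => by
    have := strongConvexOn_segment hV (hmem p hp) (hmem q hq) hl
    have e : x + p • v + l • (x + q • v - (x + p • v)) = x + (p + l * (q - p)) • v := by
      ext i; simp; ring
    rw [e] at this
    have e2 : ∑ i, ((x + q • v) i - (x + p • v) i) ^ 2 = (q - p) ^ 2 * S := by
      rw [hS, Finset.mul_sum]
      refine Finset.sum_congr rfl fun i _ => ?_
      simp; ring
    rw [e2] at this
    linarith
  have key : ∀ r ∈ Set.Icc (0 : ℝ) 1,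
      V (x + t • v) + V (x + r • v) + c * S / 2 * (t * (1 - t)) ≤
        V (x + (0 : ℝ) • v) + V (x + (1 : ℝ) • v) →
      (6 * s * (1 - s)) ^ 2 * S * (ρ x * ρ (x + v)) ≤
        24 * b ^ 2 / (a ^ 2 * c) * (ρ (x + t • v) * ρ (x + r • v)) := fun r hr h => by
    rw [zero_smul, add_zero, one_smul] at h
    set u := c * S / 2 * (t * (1 - t)) with hu
    have hu0 : 0 ≤ u := by
      have : 0 ≤ t * (1 - t) := mul_nonneg htm.1 (by linarith [htm.2])
      positivity
    have h1 : ρ x * ρ (x + v) ≤ b ^ 2 * (Real.exp (-V (x + t • v)) * Real.exp (-V (x + r • v))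
        * Real.exp (-u)) := by
      calc ρ x * ρ (x + v) ≤ (b * Real.exp (-V x)) * (b * Real.exp (-V (x + v))) :=
            mul_le_mul (hab x hx).2 (hab _ hy).2 (hnn _) (by positivity)
        _ = b ^ 2 * Real.exp (-(V x + V (x + v))) := by
            rw [neg_add, Real.exp_add]; ring
        _ ≤ b ^ 2 * Real.exp (-(V (x + t • v) + V (x + r • v) + u)) := by
            gcongr
        _ = _ := by rw [neg_add, neg_add, Real.exp_add, Real.exp_add]
    have h2 : Real.exp (-V (x + t • v)) * Real.exp (-V (x + r • v)) ≤
        (ρ (x + t • v) * ρ (x + r • v)) / a ^ 2 := by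
      rw [le_div_iff₀ (by positivity)]
      calc _ = (a * Real.exp (-V (x + t • v))) * (a * Real.exp (-V (x + r • v))) := by ring
        _ ≤ _ := mul_le_mul (hab _ (hmem t htm)).1 (hab _ (hmem r hr)).1 (by positivity) (hnn _)
    -- The exponential of the gain absorbs the factor `|v|²`; no bound on the diameter of `X` is
    -- needed.
    have h3 : u * Real.exp (-u) ≤ 1 := by
      rw [Real.exp_neg, ← div_eq_mul_inv, div_le_one (Real.exp_pos _)]
      linarith [Real.add_one_le_exp u]
    have h4 : (6 * s * (1 - s)) ^ 2 * S ≤ 24 / c * u := by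
      have := mul_le_mul_of_nonneg_right (smoothstep_slope_sq_le hs) hS0
      refine this.trans (le_of_eq ?_)
      rw [hu]; field_simp; ring
    set q := ρ (x + t • v) * ρ (x + r • v)
    have hq : 0 ≤ q := mul_nonneg (hnn _) (hnn _)
    calc (6 * s * (1 - s)) ^ 2 * S * (ρ x * ρ (x + v))
        ≤ (24 / c * u) * (b ^ 2 * (q / a ^ 2 * Real.exp (-u))) := by
          refine mul_le_mul h4 (h1.trans ?_) (mul_nonneg (hnn _) (hnn _)) (by positivity)
          gcongr
      _ = 24 * b ^ 2 / (a ^ 2 * c) * q * (u * Real.exp (-u)) := by field_simp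
      _ ≤ 24 * b ^ 2 / (a ^ 2 * c) * q * 1 := by gcongr
      _ = _ := mul_one _
  have hl := partnerLeft_mem htm
  have hr := partnerRight_mem htm
  rcases partner_le_endpoints (g := fun r => V (x + r • v)) (mul_nonneg hc.le hS0) hg htm
    with h | h
  · refine (key _ hl h).trans ?_
    gcongr
    · exact hnn _
    · linarith [hnn (x + partnerRight t • v)]
  · refine (key _ hr h).trans ?_
    gcongr
    · exact hnn _
    · linarith [hnn (x + partnerLeft t • v)]

/-! ### Absolute continuity on lines and weak derivatives. -/

lemma AbsContOn.mono {m : ℕ} {X Y : Set (Fin m → ℝ)} {f : (Fin m → ℝ) → ℝ}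
    (hf : AbsContOn X f) (hYX : Y ⊆ X) : AbsContOn Y f := fun i => by
  filter_upwards [hf i] with x hx s t h using hx s t fun r hr => hYX (h r hr)

/-- Integration by parts on the line against a compactly supported function. -/
lemma integral_mul_deriv_eq_neg_of_hasCompactSupport {F Ψ : ℝ → ℝ} {J : Set ℝ} (hJ : IsOpen J)
    (hJc : J.OrdConnected)
    (hF : ∀ s t, (∀ r ∈ Set.uIcc s t, r ∈ J) → AbsolutelyContinuousOnInterval F s t)
    (hΨ : ContDiff ℝ 1 Ψ) (hc : HasCompactSupport Ψ) (hs : tsupport Ψ ⊆ J) :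
    ∫ r, F r * deriv Ψ r = -∫ r, deriv F r * Ψ r := by
  rcases (tsupport Ψ).eq_empty_or_nonempty with he | hne
  · have h0 : Ψ = 0 := tsupport_eq_empty_iff.1 he
    subst h0
    simp
  obtain ⟨p, hp⟩ := IsCompact.exists_isLeast hc hne
  -- The extreme points of the support are pushed slightly outwards inside `J`, so that `Ψ` vanishes
  -- at both ends and the boundary terms drop.
  obtain ⟨q, hq⟩ := IsCompact.exists_isGreatest hc hne
  obtain ⟨ε₁, hε₁, h₁⟩ := Metric.isOpen_iff.1 hJ p (hs hp.1)
  obtain ⟨ε₂, hε₂, h₂⟩ := Metric.isOpen_iff.1 hJ q (hs hq.1)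
  have hpq : p ≤ q := hp.2 hq.1
  have hs' : p - ε₁ / 2 ∈ J := h₁ (by
    rw [Metric.mem_ball, Real.dist_eq, abs_lt]; constructor <;> linarith)
  have ht' : q + ε₂ / 2 ∈ J := h₂ (by
    rw [Metric.mem_ball, Real.dist_eq, abs_lt]; constructor <;> linarith)
  set s := p - ε₁ / 2
  set t := q + ε₂ / 2
  have hst : s ≤ t := by simp only [s, t]; linarith
  have hsub : tsupport Ψ ⊆ Set.Ioo s t := fun r hr =>
    ⟨by have := hp.2 hr; simp only [s]; linarith, by have := hq.2 hr; simp only [t]; linarith⟩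
  have hΨs : Ψ s = 0 := image_eq_zero_of_notMem_tsupport fun h => (hsub h).1.false
  have hΨt : Ψ t = 0 := image_eq_zero_of_notMem_tsupport fun h => (hsub h).2.false
  have hFa : AbsolutelyContinuousOnInterval F s t :=
    hF s t fun r hr => hJc.uIcc_subset hs' ht' hr
  have hΨa : AbsolutelyContinuousOnInterval Ψ s t :=
    ContDiffOn.absolutelyContinuousOnInterval hΨ.contDiffOn
  have h := hFa.integral_mul_deriv_eq_deriv_mul hΨa
  rw [hΨs, hΨt, mul_zero, mul_zero, sub_zero, zero_sub] at h
  rwa [intervalIntegral.integral_eq_integral_of_support_subset,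
    intervalIntegral.integral_eq_integral_of_support_subset] at h
  · intro r hr
    exact Set.Ioo_subset_Ioc_self (hsub (subset_tsupport _ (right_ne_zero_of_mul hr)))
  · intro r hr
    exact Set.Ioo_subset_Ioc_self
      (hsub (support_deriv_subset (right_ne_zero_of_mul hr)))

lemma pderiv_insertNth {m : ℕ} (f : (Fin (m + 1) → ℝ) → ℝ) (i : Fin (m + 1)) (r : ℝ)
    (x : Fin m → ℝ) :
    pderiv f i (i.insertNth r x) = deriv (fun r => f (i.insertNth r x)) r := by
  unfold pderiv lineDeriv
  have : (fun t : ℝ => f ((i.insertNth r x : Fin (m + 1) → ℝ) + t • Pi.single i 1))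
      = fun t => (fun r => f (i.insertNth r x)) (r + t) := by
    funext t
    simp only
    congr 1
    ext j
    refine Fin.succAboveCases i ?_ (fun k => ?_) j
    · simp
    · simp [Fin.succAbove_ne]
  rw [this, deriv_comp_const_add (fun r => f (i.insertNth r x)), add_zero]

/-- The classical partial derivatives of a function that is absolutely continuous on lines are
its weak derivatives. -/
lemma integral_mul_pderiv_eq_neg {m : ℕ} {Ω : Set (Fin m → ℝ)} (hΩ : IsOpen Ω)
    (hΩc : Convex ℝ Ω) {f : (Fin m → ℝ) → ℝ} (hf : AbsContOn Ω f) {ψ : (Fin m → ℝ) → ℝ}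
    (hψ : ContDiff ℝ 1 ψ) (hc : HasCompactSupport ψ) (hs : tsupport ψ ⊆ Ω) (i : Fin m)
    (h₁ : Integrable fun x => f x * pderiv ψ i x) (h₂ : Integrable fun x => pderiv f i x * ψ x) :
    ∫ x, f x * pderiv ψ i x = -∫ x, pderiv f i x * ψ x := by
  cases m with
  | zero => exact i.elim0
  | succ m =>
  let e := (MeasurableEquiv.piFinSuccAbove (fun _ : Fin (m + 1) => ℝ) i).symm
  have he : MeasurePreserving e volume volume :=
    (volume_preserving_piFinSuccAbove (fun _ : Fin (m + 1) => ℝ) i).symm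
  have hea : ∀ r x, e (r, x) = i.insertNth r x := fun r x => rfl
  have hline : ∀ᵐ x : Fin m → ℝ, ∀ s t : ℝ,
      (∀ r ∈ Set.uIcc s t, i.insertNth r x ∈ Ω) →
        AbsolutelyContinuousOnInterval (fun r => f (i.insertNth r x)) s t := by
    have h := he.quasiMeasurePreserving.ae (hf i)
    rw [Measure.volume_eq_prod] at h
    -- The condition concerns a whole line, so it does not depend on the `i`-th coordinate of its
    -- base point: one value `r₀` serves for almost all lines.
    obtain ⟨r₀, h₀⟩ := (Measure.ae_ae_of_ae_prod h).exists
    filter_upwards [h₀] with x hx s t hst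
    simp only [hea, Fin.update_insertNth] at hx
    exact hx s t hst
  rw [← he.integral_comp', ← he.integral_comp', Measure.volume_eq_prod, integral_prod_symm,
    integral_prod_symm, ← integral_neg]
  rotate_left
  · exact (he.integrable_comp_emb e.measurableEmbedding).2 h₂
  · exact (he.integrable_comp_emb e.measurableEmbedding).2 h₁
  refine integral_congr_ae ?_
  filter_upwards [hline] with x hx
  have hcont : Continuous fun r : ℝ => (i.insertNth r x : Fin (m + 1) → ℝ) :=
    Continuous.finInsertNth i continuous_id continuous_const
  have hsm : ContDiff ℝ 1 fun r : ℝ => (i.insertNth r x : Fin (m + 1) → ℝ) := by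
    rw [contDiff_pi]
    intro j
    refine Fin.succAboveCases i ?_ (fun k => ?_) j
    · simpa using contDiff_fun_id
    · simpa using contDiff_const
  have hsupp : tsupport (fun r => ψ (i.insertNth r x)) ⊆
      (fun r : ℝ => (i.insertNth r x : Fin (m + 1) → ℝ)) ⁻¹' tsupport ψ :=
    tsupport_comp_subset_preimage ψ hcont
  simp only [hea, pderiv_insertNth]
  refine integral_mul_deriv_eq_neg_of_hasCompactSupport
    (J := (fun r : ℝ => (i.insertNth r x : Fin (m + 1) → ℝ)) ⁻¹' Ω)
    (hΩ.preimage hcont) ?_ hx (hψ.comp hsm) ?_ (hsupp.trans (Set.preimage_mono hs))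
  · refine ⟨fun p hp q hq r hr => ?_⟩
    rw [← segment_eq_Icc (hr.1.trans hr.2)] at hr
    obtain ⟨a, b, ha, hb, hab, rfl⟩ := hr
    have := hΩc hp hq ha hb hab
    simp only [Set.mem_preimage]
    convert this using 1
    ext j
    refine Fin.succAboveCases i ?_ (fun k => ?_) j
    · simp
    · simp [← add_mul, hab]
  · refine HasCompactSupport.intro (IsCompact.image hc (continuous_apply i)) fun r hr => ?_
    by_contra h
    exact hr ⟨_, subset_tsupport _ h, by simp⟩

/-! ### Local integrability with respect to Lebesgue measure. -/

/-- The density is bounded below on compact subsets of the interior of its domain. -/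
lemma exists_pos_le_density {m : ℕ} {X : Set (Fin m → ℝ)} {ρ : (Fin m → ℝ) → ℝ}
    (hXρ : StronglyLogConcaveType X ρ) {K : Set (Fin m → ℝ)}
    (hK : IsCompact K) (hKX : K ⊆ interior X) : ∃ δ : ℝ, 0 < δ ∧ ∀ x ∈ K, δ ≤ ρ x := by
  obtain ⟨_, V, a, b, c, ha, hb, hc, hV, hab⟩ := hXρ
  have hcont : ContinuousOn V (interior X) := by
    have h := hV.continuousOn_interior.add
      (f := fun x => V x - c / 2 * ∑ i, x i ^ 2) (g := fun x => c / 2 * ∑ i, x i ^ 2)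
      (Continuous.continuousOn (by fun_prop))
    refine h.congr fun x _ => ?_
    simp
  obtain ⟨M, hM⟩ := hK.bddAbove_image (hcont.mono hKX)
  refine ⟨a * Real.exp (-M), by positivity, fun x hx => ?_⟩
  refine le_trans ?_ (hab x (interior_subset (hKX hx))).1
  have := hM (Set.mem_image_of_mem V hx)
  gcongr

lemma IsInputDensity.isProbabilityMeasure {m : ℕ} {X : Set (Fin m → ℝ)} {ρ : (Fin m → ℝ) → ℝ}
    (hρ : IsInputDensity X ρ) : IsProbabilityMeasure (inputMeasure ρ) :=
  ⟨by rw [inputMeasure, withDensity_apply _ MeasurableSet.univ, Measure.restrict_univ, hρ.total]⟩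

lemma volume_restrict_le_inputMeasure {m : ℕ} {ρ : (Fin m → ℝ) → ℝ} {K : Set (Fin m → ℝ)}
    (hK : MeasurableSet K) {δ : ℝ} (hδ : 0 < δ) (h : ∀ x ∈ K, δ ≤ ρ x) :
    volume.restrict K ≤ (ENNReal.ofReal δ)⁻¹ • inputMeasure ρ := by
  refine Measure.le_iff.2 fun s hs => ?_
  have hδ' : ENNReal.ofReal δ ≠ 0 := by simpa using hδ
  rw [Measure.restrict_apply hs, Measure.smul_apply, smul_eq_mul, inputMeasure,
    withDensity_apply _ hs, ← ENNReal.mul_le_mul_iff_right hδ' ENNReal.ofReal_ne_top,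
    ← mul_assoc, ENNReal.mul_inv_cancel hδ' ENNReal.ofReal_ne_top, one_mul,
    ← setLIntegral_const]
  refine (setLIntegral_mono' (hs.inter hK) fun x hx => ?_).trans
    (lintegral_mono_set Set.inter_subset_left)
  exact ENNReal.ofReal_le_ofReal (h x hx.2)

/-- On `K` the density is bounded below, so Lebesgue measure is dominated by a multiple of the input
measure, for which square-integrability implies integrability. -/
lemma integrableOn_of_memLp_inputMeasure {m : ℕ} {X : Set (Fin m → ℝ)} {ρ : (Fin m → ℝ) → ℝ}
    (hρ : IsInputDensity X ρ) (hXρ : StronglyLogConcaveType X ρ) {h : (Fin m → ℝ) → ℝ}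
    (hh : MemLp h 2 (inputMeasure ρ)) {K : Set (Fin m → ℝ)}
    (hK : IsCompact K) (hKX : K ⊆ interior X) : IntegrableOn h K := by
  have := hρ.isProbabilityMeasure
  obtain ⟨δ, hδ, hle⟩ := exists_pos_le_density hXρ hK hKX
  have hi : Integrable h (inputMeasure ρ) := hh.integrable (by norm_num)
  exact (hi.smul_measure (by simpa using hδ)).mono_measure
    (volume_restrict_le_inputMeasure hK.measurableSet hδ hle)

/-! ### Increments along segments in an arbitrary direction. -/

section WeakDerivative

lemma integrable_mul_of_integrableOn_tsupport {E : Type*} [TopologicalSpace E]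
    [MeasurableSpace E] [BorelSpace E] {μ : Measure E} {φ h : E → ℝ} (hφ : Continuous φ)
    (hφc : HasCompactSupport φ) (hh : IntegrableOn h (tsupport φ) μ) :
    Integrable (fun x => φ x * h x) μ := by
  obtain ⟨B, hB⟩ := hφc.exists_bound_of_continuous hφ
  have h1 : Integrable (fun x => φ x * (tsupport φ).indicator h x) μ :=
    ((integrable_indicator_iff (isClosed_tsupport φ).measurableSet).2 hh).bdd_mul
      hφ.aestronglyMeasurable (Filter.Eventually.of_forall hB)
  refine h1.congr (Filter.Eventually.of_forall fun x => ?_)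
  by_cases hx : x ∈ tsupport φ
  · simp [Set.indicator_of_mem hx]
  · simp [image_eq_zero_of_notMem_tsupport hx]

variable {E : Type*} [NormedAddCommGroup E] [NormedSpace ℝ E]

lemma isCompact_image_segment {K : Set E} (hK : IsCompact K) (v : E) :
    IsCompact ((fun q : E × ℝ => q.1 + q.2 • v) '' (K ×ˢ Set.Icc (0 : ℝ) 1)) :=
  (hK.prod isCompact_Icc).image (by fun_prop)

lemma image_segment_subset {Ω K : Set E} (hΩ : Convex ℝ Ω) {v : E} (hK : K ⊆ Ω)
    (hKv : ∀ x ∈ K, x + v ∈ Ω) :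
    (fun q : E × ℝ => q.1 + q.2 • v) '' (K ×ˢ Set.Icc (0 : ℝ) 1) ⊆ Ω := by
  rintro _ ⟨⟨x, t⟩, ⟨hx, ht⟩, rfl⟩
  have := hΩ (hK hx) (hKv x hx) (sub_nonneg.2 ht.2) ht.1 (by ring)
  convert this using 1
  simp only [smul_add, sub_smul, one_smul]
  abel

/-- The integrand is the derivative in `s` of `-φ (x - smoothstep s • v)`. -/
lemma integral_slope_fderiv {φ : E → ℝ} (hφ : ContDiff ℝ 1 φ) (x v : E) :
    ∫ s in Set.Ioc (0 : ℝ) 1, 6 * s * (1 - s) * fderiv ℝ φ (x - smoothstep s • v) v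
      = φ x - φ (x - v) := by
  have hcs := continuous_smoothstep
  have hfd : Continuous (fderiv ℝ φ) := hφ.continuous_fderiv one_ne_zero
  have hd : ∀ s : ℝ, HasDerivAt (fun s => - φ (x - smoothstep s • v))
      (6 * s * (1 - s) * fderiv ℝ φ (x - smoothstep s • v) v) s := fun s => by
    have h1 : HasDerivAt (fun s => x - smoothstep s • v) (-((6 * s * (1 - s)) • v)) s :=
      ((hasDerivAt_smoothstep s).smul_const v).const_sub x
    have h2 := ((hφ.differentiable one_ne_zero).differentiableAt.hasFDerivAt
      (x := x - smoothstep s • v)).comp_hasDerivAt s h1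
    refine (h2.neg).congr_deriv ?_
    simp
  rw [← intervalIntegral.integral_of_le zero_le_one,
    intervalIntegral.integral_eq_sub_of_hasDerivAt (fun s _ => hd s)]
  · simp [smoothstep]
    norm_num
    ring
  · refine Continuous.intervalIntegrable ?_ _ _
    have : Continuous fun s => fderiv ℝ φ (x - smoothstep s • v) v :=
      (hfd.comp (by fun_prop)).clm_apply continuous_const
    fun_prop

variable [MeasurableSpace E] [BorelSpace E] [FiniteDimensional ℝ E] {μ : Measure E}
  [μ.IsAddHaarMeasure]

/-- Translation preserves the `L¹` norm, so the norm for fixed `s` is a continuous function of `s`;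
this licenses Fubini in the duality argument that follows. -/
lemma integrable_slope_mul_translate {h : E → ℝ} (hm : Measurable h) (hh : Integrable h μ)
    (v : E) :
    Integrable (fun q : E × ℝ => 6 * q.2 * (1 - q.2) * h (q.1 + smoothstep q.2 • v))
      (μ.prod (volume.restrict (Set.Ioc 0 1))) := by
  have hcs := continuous_smoothstep
  have hmeas : Measurable
      (fun q : E × ℝ => 6 * q.2 * (1 - q.2) * h (q.1 + smoothstep q.2 • v)) := by
    refine Measurable.mul (by fun_prop) (hm.comp ?_)
    exact (Continuous.measurable (by fun_prop))
  rw [integrable_prod_iff' hmeas.aestronglyMeasurable]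
  refine ⟨Filter.Eventually.of_forall fun s => (hh.comp_add_right (smoothstep s • v)).const_mul (6 * s * (1 - s)), ?_⟩
  have : (fun s : ℝ => ∫ x, ‖6 * s * (1 - s) * h (x + smoothstep s • v)‖ ∂μ)
      = fun s => |6 * s * (1 - s)| * ∫ x, ‖h x‖ ∂μ := by
    funext s
    simp only [norm_mul (6 * s * (1 - s)), integral_const_mul]
    rw [integral_add_right_eq_self (fun x => ‖h x‖)]
    rfl
  simp only [this]
  refine IntegrableOn.mono_set (t := Set.Icc 0 1) ?_ Set.Ioc_subset_Icc_self
  exact (Continuous.continuousOn (by fun_prop)).integrableOn_compact isCompact_Icc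

/-- If `g` is the weak derivative of `f` in the direction `v` on a convex open set, then `g`
integrates to the increment of `f` along almost every segment with direction `v`. -/
lemma ae_sub_eq_integral_of_weak_deriv {Ω : Set E} (hΩ : IsOpen Ω) (hΩc : Convex ℝ Ω)
    {f g : E → ℝ} (hgm : Measurable g)
    (hf : ∀ K ⊆ Ω, IsCompact K → IntegrableOn f K μ)
    (hg : ∀ K ⊆ Ω, IsCompact K → IntegrableOn g K μ) (v : E)
    (hfg : ∀ ψ : E → ℝ, ContDiff ℝ 1 ψ → HasCompactSupport ψ → tsupport ψ ⊆ Ω →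
      ∫ x, f x * fderiv ℝ ψ x v ∂μ = -∫ x, g x * ψ x ∂μ) :
    ∀ᵐ x ∂μ, x ∈ Ω → x + v ∈ Ω → f (x + v) - f x =
      ∫ s in Set.Ioc (0 : ℝ) 1, 6 * s * (1 - s) * g (x + smoothstep s • v) := by
  have hcs := continuous_smoothstep
  set U : Set E := Ω ∩ (fun x => x + v) ⁻¹' Ω with hU
  have hUo : IsOpen U := hΩ.inter (hΩ.preimage (by fun_prop))
  set S : E → ℝ := fun x =>
    ∫ s in Set.Ioc (0 : ℝ) 1, 6 * s * (1 - s) * g (x + smoothstep s • v) with hS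
  -- The set swept out by moving `K` along `v` is compact and, by convexity, still inside `Ω`.
  -- Cutting `f` and `g` off outside it makes them integrable on the whole space without changing
  -- any integral against a test function supported in `K`.
  set hull : Set E → Set E :=
    fun K => (fun q : E × ℝ => q.1 + q.2 • v) '' (K ×ˢ Set.Icc (0 : ℝ) 1) with hhull
  have hullc : ∀ K, IsCompact K → IsCompact (hull K) := fun K hK => isCompact_image_segment hK v
  have hullΩ : ∀ K ⊆ U, hull K ⊆ Ω := fun K hK =>
    image_segment_subset hΩc (fun x hx => (hK hx).1) fun x hx => (hK hx).2
  have hullm : ∀ K, ∀ x ∈ K, ∀ t ∈ Set.Icc (0 : ℝ) 1, x + t • v ∈ hull K :=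
    fun K x hx t ht => ⟨(x, t), ⟨hx, ht⟩, rfl⟩
  have hgi : ∀ K ⊆ U, IsCompact K → Integrable ((hull K).indicator g) μ := fun K hKU hK =>
    (integrable_indicator_iff (hullc K hK).measurableSet).2 (hg _ (hullΩ K hKU) (hullc K hK))
  have hfi : ∀ K ⊆ U, IsCompact K → Integrable ((hull K).indicator f) μ := fun K hKU hK =>
    (integrable_indicator_iff (hullc K hK).measurableSet).2 (hf _ (hullΩ K hKU) (hullc K hK))
  have hgim : ∀ K, IsCompact K → Measurable ((hull K).indicator g) := fun K hK =>
    hgm.indicator (hullc K hK).measurableSet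
  have hSeq : ∀ K, ∀ x ∈ K, S x = ∫ s in Set.Ioc (0 : ℝ) 1,
      6 * s * (1 - s) * (hull K).indicator g (x + smoothstep s • v) := fun K x hx => by
    refine setIntegral_congr_fun measurableSet_Ioc fun s hs => ?_
    rw [Set.indicator_of_mem]
    exact hullm K x hx _ (smoothstep_mem (Set.Ioc_subset_Icc_self hs))
  have hSi : ∀ K ⊆ U, IsCompact K → IntegrableOn S K μ := fun K hKU hK => by
    have h := (integrable_slope_mul_translate (hgim K hK) (hgi K hKU hK) v).integral_prod_left
    exact h.integrableOn.congr_fun (fun x hx => (hSeq K x hx).symm) hK.measurableSet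
  have hf1 : ∀ K ⊆ U, IsCompact K → IntegrableOn f K μ := fun K hKU hK =>
    hf K (hKU.trans Set.inter_subset_left) hK
  have hf2 : ∀ K ⊆ U, IsCompact K → IntegrableOn (fun x => f (x + v)) K μ := fun K hKU hK => by
    have h : Integrable (fun x => (hull K).indicator f (x + v)) μ :=
      (hfi K hKU hK).comp_add_right v
    refine h.integrableOn.congr_fun (fun x hx => ?_) hK.measurableSet
    have := hullm K x hx 1 (by simp)
    rw [one_smul] at this
    exact Set.indicator_of_mem this f
  have hloc : LocallyIntegrableOn (fun x => f (x + v) - f x - S x) U μ :=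
    (locallyIntegrableOn_iff hUo.isLocallyClosed).2 fun K hKU hK =>
      ((hf2 K hKU hK).sub (hf1 K hKU hK)).sub (hSi K hKU hK)
  -- The identity is proved by duality: its defect integrates to zero against every test function
  -- supported in `U`.
  have hmain := hUo.ae_eq_zero_of_integral_contDiff_smul_eq_zero hloc (μ := μ) ?_
  · filter_upwards [hmain] with x hx h1 h2
    have := hx ⟨h1, h2⟩
    linarith
  intro φ hφ hφc hφU
  have hφ1 : ContDiff ℝ 1 φ := hφ.of_le (by exact_mod_cast le_top)
  have hφcont : Continuous φ := hφ.continuous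
  obtain ⟨B, hB⟩ := hφc.exists_bound_of_continuous hφcont
  have hfdcont : Continuous (fderiv ℝ φ) := hφ1.continuous_fderiv one_ne_zero
  obtain ⟨B', hB'⟩ := (hφc.fderiv (𝕜 := ℝ)).exists_bound_of_continuous hfdcont
  set K := tsupport φ with hKdef
  have hK : IsCompact K := hφc
  have hint : ∀ h : E → ℝ, IntegrableOn h K μ → Integrable (fun x => φ x * h x) μ :=
    fun h hh => integrable_mul_of_integrableOn_tsupport hφcont hφc hh
  have hcutφ : ∀ (h : E → ℝ) (t : ℝ), t ∈ Set.Icc (0 : ℝ) 1 → ∀ x,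
      (hull K).indicator h x * φ (x - t • v) = h x * φ (x - t • v) := fun h t ht x => by
    by_cases hx : x - t • v ∈ K
    · have := hullm K _ hx t ht
      rw [sub_add_cancel] at this
      rw [Set.indicator_of_mem this]
    · rw [image_eq_zero_of_notMem_tsupport hx, mul_zero, mul_zero]
  have hcutd : ∀ (h : E → ℝ) (t : ℝ), t ∈ Set.Icc (0 : ℝ) 1 → ∀ x,
      (hull K).indicator h x * fderiv ℝ φ (x - t • v) v = h x * fderiv ℝ φ (x - t • v) v :=
    fun h t ht x => by
    by_cases hx : x - t • v ∈ K
    · have := hullm K _ hx t ht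
      rw [sub_add_cancel] at this
      rw [Set.indicator_of_mem this]
    · have : fderiv ℝ φ (x - t • v) = 0 := by
        by_contra hne
        exact hx (support_fderiv_subset ℝ hne)
      simp [this]
  have hweak : ∀ t ∈ Set.Icc (0 : ℝ) 1,
      ∫ x, (hull K).indicator g x * φ (x - t • v) ∂μ =
        -∫ x, (hull K).indicator f x * fderiv ℝ φ (x - t • v) v ∂μ := fun t ht => by
    simp only [hcutφ g t ht, hcutd f t ht]
    have hc : HasCompactSupport fun x => φ (x - t • v) :=
      hφc.comp_homeomorph (Homeomorph.subRight (t • v))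
    have hsub : tsupport (fun x => φ (x - t • v)) ⊆ Ω := by
      refine (tsupport_comp_subset_preimage φ (f := fun x => x - t • v) (by fun_prop)).trans ?_
      intro x hx
      have := hullm K _ hx t ht
      rw [sub_add_cancel] at this
      exact hullΩ K hφU this
    have h := hfg (fun x => φ (x - t • v)) (hφ1.comp (contDiff_id.sub contDiff_const)) hc hsub
    simp only [fderiv_comp_sub] at h
    rw [h, neg_neg]
  have hSφ : ∫ x, φ x * S x ∂μ
      = ∫ x, (hull K).indicator f x * (φ (x - v) - φ x) ∂μ := by
    have hΦ := (integrable_slope_mul_translate (hgim K hK) (hgi K hφU hK) v)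
    have hΦ' : Integrable (Function.uncurry fun (x : E) (s : ℝ) =>
        φ x * (6 * s * (1 - s) * (hull K).indicator g (x + smoothstep s • v)))
        (μ.prod (volume.restrict (Set.Ioc 0 1))) :=
      hΦ.bdd_mul (f := fun q : E × ℝ => φ q.1) (c := B)
        (Continuous.aestronglyMeasurable (by fun_prop)) (Filter.Eventually.of_forall fun q => hB q.1)
    have hΨ' : Integrable (Function.uncurry fun (x : E) (s : ℝ) =>
        (6 * s * (1 - s) * fderiv ℝ φ (x - smoothstep s • v) v) * (hull K).indicator f x)
        (μ.prod (volume.restrict (Set.Ioc 0 1))) := by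
      have h1 : Integrable (fun q : E × ℝ => (hull K).indicator f q.1 * (1 : ℝ))
          (μ.prod (volume.restrict (Set.Ioc 0 1))) :=
        (hfi K hφU hK).mul_prod (integrable_const (1 : ℝ))
      simp only [mul_one] at h1
      refine h1.bdd_mul (f := fun q : E × ℝ =>
        6 * q.2 * (1 - q.2) * fderiv ℝ φ (q.1 - smoothstep q.2 • v) v) (c := 6 * (B' * ‖v‖)) ?_ ?_
      · have : Continuous fun q : E × ℝ => fderiv ℝ φ (q.1 - smoothstep q.2 • v) v :=
          (hfdcont.comp (by fun_prop)).clm_apply continuous_const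
        exact Continuous.aestronglyMeasurable (by fun_prop)
      · have hae : ∀ᵐ q : E × ℝ ∂(μ.prod (volume.restrict (Set.Ioc (0 : ℝ) 1))),
            q.2 ∈ Set.Ioc (0 : ℝ) 1 :=
          Measure.quasiMeasurePreserving_snd.ae (ae_restrict_mem measurableSet_Ioc)
        filter_upwards [hae] with q hq
        rw [norm_mul]
        refine mul_le_mul ?_ ((ContinuousLinearMap.le_opNorm _ _).trans ?_) (norm_nonneg _)
          (by norm_num)
        · rw [Real.norm_eq_abs, abs_of_nonneg]
          · nlinarith [hq.1, hq.2]
          · have := hq.1.le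
            have : 0 ≤ 1 - q.2 := by linarith [hq.2]
            positivity
        · gcongr
          exact hB' _
    calc ∫ x, φ x * S x ∂μ
        = ∫ x, (∫ s in Set.Ioc (0 : ℝ) 1,
            φ x * (6 * s * (1 - s) * (hull K).indicator g (x + smoothstep s • v))) ∂μ := by
          refine integral_congr_ae (Filter.Eventually.of_forall fun x => ?_)
          simp only
          rw [integral_const_mul]
          by_cases hx : x ∈ K
          · rw [hSeq K x hx]
          · rw [image_eq_zero_of_notMem_tsupport hx, zero_mul, zero_mul]
      _ = ∫ s in Set.Ioc (0 : ℝ) 1, ∫ x,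
            φ x * (6 * s * (1 - s) * (hull K).indicator g (x + smoothstep s • v)) ∂μ :=
          integral_integral_swap hΦ'
      -- For fixed `s`, translate so that the shift falls on `φ`, then use the weak derivative
      -- against the shifted test function.
      _ = ∫ s in Set.Ioc (0 : ℝ) 1, -∫ x,
            (6 * s * (1 - s) * fderiv ℝ φ (x - smoothstep s • v) v) *
              (hull K).indicator f x ∂μ := by
          refine setIntegral_congr_fun measurableSet_Ioc fun s hs => ?_
          have h1 := hweak (smoothstep s) (smoothstep_mem (Set.Ioc_subset_Icc_self hs))
          have h2 : ∫ x, φ x * (6 * s * (1 - s) * (hull K).indicator g (x + smoothstep s • v)) ∂μ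
              = 6 * s * (1 - s) *
                ∫ x, (hull K).indicator g x * φ (x - smoothstep s • v) ∂μ := by
            rw [← integral_add_right_eq_self
              (fun x => (hull K).indicator g x * φ (x - smoothstep s • v)) (smoothstep s • v),
              ← integral_const_mul]
            congr 1
            funext x
            rw [add_sub_cancel_right]
            ring
          rw [h2, h1, mul_neg, ← integral_const_mul]
          congr 2
          funext x
          ring
      _ = -∫ x, (∫ s in Set.Ioc (0 : ℝ) 1,
            (6 * s * (1 - s) * fderiv ℝ φ (x - smoothstep s • v) v) *
              (hull K).indicator f x) ∂μ := by
          rw [integral_neg, integral_integral_swap hΨ']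
      _ = _ := by
          rw [← integral_neg]
          congr 1
          funext x
          rw [integral_mul_const, integral_slope_fderiv hφ1]
          ring
  have hfφ : ∫ x, (hull K).indicator f x * (φ (x - v) - φ x) ∂μ
      = ∫ x, φ x * f (x + v) ∂μ - ∫ x, φ x * f x ∂μ := by
    have e0 : ∀ x, (hull K).indicator f x * φ x = φ x * f x := fun x => by
      have := hcutφ f 0 (by simp) x
      rw [zero_smul, sub_zero] at this
      rw [this, mul_comm]
    have e1 : ∀ x, (hull K).indicator f x * φ (x - v) = f x * φ (x - v) := fun x => by
      have := hcutφ f 1 (by simp) x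
      rwa [one_smul] at this
    have hi := hint _ (hf2 K hφU hK)
    have hi1 : Integrable (fun x => f x * φ (x - v)) μ := by
      refine (hi.comp_sub_right v).congr (Filter.Eventually.of_forall fun x => ?_)
      simp only [sub_add_cancel]
      ring
    simp only [mul_sub, e0, e1]
    rw [integral_sub hi1 (hint _ (hf1 K hφU hK)),
      ← integral_add_right_eq_self (fun x => f x * φ (x - v)) v]
    simp only [add_sub_cancel_right, mul_comm]
  simp only [smul_eq_mul, mul_sub]
  rw [integral_sub, integral_sub, hSφ, hfφ, sub_self]
  · exact hint _ (hf2 K hφU hK)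
  · exact hint _ (hf1 K hφU hK)
  · exact (hint _ (hf2 K hφU hK)).sub (hint _ (hf1 K hφU hK))
  · exact hint _ (hSi K hφU hK)

end WeakDerivative

/-! ### A measurable gradient and the squared increment bound. -/

/-- The Jensen inequality for the square, valid without integrability. -/
lemma ofReal_sq_integral_le {α : Type*} [MeasurableSpace α] {ν : Measure α}
    [IsProbabilityMeasure ν] (h : α → ℝ) :
    ENNReal.ofReal ((∫ a, h a ∂ν) ^ 2) ≤ ∫⁻ a, ENNReal.ofReal (h a ^ 2) ∂ν := by
  by_cases hh : Integrable h ν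
  swap
  -- The integral of a non-integrable function is `0` by convention, so the left side vanishes.
  · simp [integral_undef hh]
  have e : ∀ r : ℝ, ENNReal.ofReal (r ^ 2) = ‖r‖ₑ ^ 2 := fun r => by
    rw [← sq_abs, ENNReal.ofReal_pow (abs_nonneg r), ← Real.enorm_eq_ofReal_abs]
  have h2 : eLpNorm h 2 ν ^ 2 = ∫⁻ a, ‖h a‖ₑ ^ 2 ∂ν := by
    have := eLpNorm_nnreal_pow_eq_lintegral (f := h) (μ := ν) (p := 2) (by norm_num)
    simpa using this
  simp only [e]
  calc ‖∫ a, h a ∂ν‖ₑ ^ 2 ≤ (∫⁻ a, ‖h a‖ₑ ∂ν) ^ 2 := by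
        gcongr; exact enorm_integral_le_lintegral_enorm h
    _ = eLpNorm h 1 ν ^ 2 := by rw [eLpNorm_one_eq_lintegral_enorm]
    _ ≤ eLpNorm h 2 ν ^ 2 := by
        gcongr
        exact eLpNorm_le_eLpNorm_of_exponent_le (by norm_num) hh.aestronglyMeasurable
    _ = _ := h2

lemma IsInputDensity.mem_of_ne_zero {m : ℕ} {X : Set (Fin m → ℝ)} {ρ : (Fin m → ℝ) → ℝ}
    (hρ : IsInputDensity X ρ) {x : Fin m → ℝ} (h : ρ x ≠ 0) : x ∈ X :=
  not_imp_comm.1 (hρ.zero x) h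

lemma ae_of_ae_inputMeasure {m : ℕ} {X : Set (Fin m → ℝ)} {ρ : (Fin m → ℝ) → ℝ}
    (hρ : IsInputDensity X ρ) {p : (Fin m → ℝ) → Prop} (h : ∀ᵐ x ∂(inputMeasure ρ), p x) :
    ∀ᵐ x, x ∈ X → p x := by
  rw [inputMeasure, ae_withDensity_iff (by have := hρ.measurable; fun_prop)] at h
  filter_upwards [h] with x hx hxX
  exact hx (by simpa using hρ.pos x hxX)

lemma ae_mem_interior_of_mem {m : ℕ} {X : Set (Fin m → ℝ)} (hX : Convex ℝ X) :
    ∀ᵐ x, x ∈ X → x ∈ interior X := by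
  have h := hX.addHaar_frontier volume
  filter_upwards [measure_eq_zero_iff_ae_notMem.1 h] with x hx hxX
  by_contra hni
  exact hx ⟨subset_closure hxX, hni⟩

lemma pderiv_eq_fderiv {m : ℕ} {ψ : (Fin m → ℝ) → ℝ} (hψ : ContDiff ℝ 1 ψ) (i : Fin m)
    (x : Fin m → ℝ) : pderiv ψ i x = fderiv ℝ ψ x (Pi.single i 1) :=
  (hψ.differentiable one_ne_zero).differentiableAt.lineDeriv_eq_fderiv

/-- A function that is absolutely continuous on lines with square-integrable partial derivatives
has a measurable gradient that controls its increments in all directions. -/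
lemma exists_measurable_gradient {m : ℕ} {X : Set (Fin m → ℝ)} {ρ : (Fin m → ℝ) → ℝ}
    (hρ : IsInputDensity X ρ) (hXρ : StronglyLogConcaveType X ρ) {f : (Fin m → ℝ) → ℝ}
    (hf : AbsContOn X f) (hf2 : MemLp f 2 (inputMeasure ρ))
    (hd : ∀ i, MemLp (pderiv f i) 2 (inputMeasure ρ)) :
    ∃ D : Fin m → (Fin m → ℝ) → ℝ, (∀ i, Measurable (D i)) ∧
      (∀ i, D i =ᵐ[inputMeasure ρ] pderiv f i) ∧
      ∀ v, ∀ᵐ x, x ∈ X → x + v ∈ X →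
        ENNReal.ofReal ((f (x + v) - f x) ^ 2) ≤ ∫⁻ s in Set.Ioc (0 : ℝ) 1,
          ENNReal.ofReal ((6 * s * (1 - s) * ∑ i, v i * D i (x + smoothstep s • v)) ^ 2) := by
  set D : Fin m → (Fin m → ℝ) → ℝ := fun i => (hd i).1.mk (pderiv f i)
  have hDm : ∀ i, Measurable (D i) := fun i => (hd i).1.stronglyMeasurable_mk.measurable
  have hDe : ∀ i, D i =ᵐ[inputMeasure ρ] pderiv f i := fun i => (hd i).1.ae_eq_mk.symm
  refine ⟨D, hDm, hDe, fun v => ?_⟩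
  have hΩc : Convex ℝ (interior X) := hXρ.1.interior
  have hfK : ∀ K ⊆ interior X, IsCompact K → IntegrableOn f K := fun K hK hKc =>
    integrableOn_of_memLp_inputMeasure hρ hXρ hf2 hKc hK
  have hDK : ∀ i, ∀ K ⊆ interior X, IsCompact K → IntegrableOn (D i) K := fun i K hK hKc =>
    integrableOn_of_memLp_inputMeasure hρ hXρ ((memLp_congr_ae (hDe i)).2 (hd i)) hKc hK
  have hpK : ∀ i, ∀ K ⊆ interior X, IsCompact K → IntegrableOn (pderiv f i) K :=
    fun i K hK hKc => integrableOn_of_memLp_inputMeasure hρ hXρ (hd i) hKc hK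
  have key := ae_sub_eq_integral_of_weak_deriv (μ := volume) isOpen_interior hΩc
    (f := f) (g := fun x => ∑ i, v i * D i x) (by fun_prop) hfK
    (fun K hK hKc => integrable_finsetSum _ fun i _ => (hDK i K hK hKc).const_mul _) v
    (fun ψ hψ hc hs => by
      have hpc : ∀ i, Continuous (pderiv ψ i) := fun i => by
        have : pderiv ψ i = fun x => fderiv ℝ ψ x (Pi.single i 1) :=
          funext fun x => pderiv_eq_fderiv hψ i x
        rw [this]
        exact (hψ.continuous_fderiv one_ne_zero).clm_apply continuous_const
      have hps : ∀ i, tsupport (pderiv ψ i) ⊆ tsupport ψ := fun i => by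
        refine closure_minimal (fun x hx => ?_) (isClosed_tsupport ψ)
        refine support_fderiv_subset ℝ (f := ψ) fun h0 => hx ?_
        rw [pderiv_eq_fderiv hψ, h0]
        rfl
      have hpcs : ∀ i, HasCompactSupport (pderiv ψ i) := fun i =>
        IsCompact.of_isClosed_subset hc (isClosed_tsupport _) (hps i)
      have i1 : ∀ i, Integrable fun x => f x * pderiv ψ i x := fun i => by
        simp only [mul_comm (f _)]
        exact integrable_mul_of_integrableOn_tsupport (hpc i) (hpcs i)
          (hfK _ ((hps i).trans hs) (hpcs i))
      have i2 : ∀ i, Integrable fun x => pderiv f i x * ψ x := fun i => by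
        simp only [mul_comm (pderiv f i _)]
        exact integrable_mul_of_integrableOn_tsupport hψ.continuous hc (hpK i _ hs hc)
      have i3 : ∀ i, Integrable fun x => D i x * ψ x := fun i => by
        simp only [mul_comm (D i _)]
        exact integrable_mul_of_integrableOn_tsupport hψ.continuous hc (hDK i _ hs hc)
      have e1 : ∀ x, f x * fderiv ℝ ψ x v = ∑ i, v i * (f x * pderiv ψ i x) := fun x => by
        have hv : v = ∑ i, v i • (Pi.single i (1 : ℝ) : Fin m → ℝ) := by
          ext j; simp [Finset.sum_apply, Pi.single_apply]
        conv_lhs => rw [hv]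
        rw [map_sum, Finset.mul_sum]
        refine Finset.sum_congr rfl fun i _ => ?_
        rw [map_smul, pderiv_eq_fderiv hψ, smul_eq_mul]
        ring
      have e2 : ∀ x, (∑ i, v i * D i x) * ψ x = ∑ i, v i * (D i x * ψ x) := fun x => by
        rw [Finset.sum_mul]
        exact Finset.sum_congr rfl fun i _ => by ring
      simp only [e1, e2]
      rw [integral_finsetSum _ fun i _ => (i1 i).const_mul _,
        integral_finsetSum _ fun i _ => (i3 i).const_mul _, ← Finset.sum_neg_distrib]
      refine Finset.sum_congr rfl fun i _ => ?_
      rw [integral_const_mul, integral_const_mul, ← mul_neg,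
        integral_mul_pderiv_eq_neg isOpen_interior hΩc (hf.mono interior_subset) hψ hc hs i
          (i1 i) (i2 i)]
      congr 2
      -- `D i` and the partial derivative agree almost everywhere for the input measure, hence
      -- Lebesgue-almost everywhere on `X`, where `ρ > 0`; `ψ` vanishes elsewhere.
      refine integral_congr_ae ?_
      filter_upwards [ae_of_ae_inputMeasure hρ (hDe i)] with x hx
      by_cases hxs : x ∈ tsupport ψ
      · rw [hx (interior_subset (hs hxs))]
      · rw [image_eq_zero_of_notMem_tsupport hxs, mul_zero, mul_zero])
  have hint := ae_mem_interior_of_mem hXρ.1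
  have hint' : ∀ᵐ x, x + v ∈ X → x + v ∈ interior X :=
    (measurePreserving_add_right volume v).quasiMeasurePreserving.ae hint
  have hprob : IsProbabilityMeasure (volume.restrict (Set.Ioc (0 : ℝ) 1)) := ⟨by simp⟩
  filter_upwards [key, hint, hint'] with x h1 h2 h3 hx hxv
  rw [h1 (h2 hx) (h3 hxv)]
  exact ofReal_sq_integral_le _

/-! ### The Poincaré inequality for pairs of points. -/

/-- The Jacobian of `v ↦ r • v` contributes `|r|` to the power minus the dimension, and `|r|⁻¹ ≤ 6`.
-/
lemma lintegral_comp_add_smul_le {ι : Type*} [Fintype ι] {P : (ι → ℝ) → ℝ≥0∞}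
    (hP : Measurable P) (z : ι → ℝ) {r : ℝ} (hr : 1 / 6 ≤ |r|) :
    ∫⁻ v, P (z + r • v) ≤ ENNReal.ofReal (6 ^ Fintype.card ι) * ∫⁻ z, P z := by
  have hr0 : r ≠ 0 := fun h => by rw [h, abs_zero] at hr; norm_num at hr
  have h : ∫⁻ v, P (z + r • v) = ∫⁻ u, P (z + u) ∂(Measure.map (fun v : ι → ℝ => r • v) volume) :=
    (lintegral_map (f := fun u => P (z + u)) (by fun_prop) (by fun_prop)).symm
  rw [h, Measure.map_addHaar_smul volume hr0, lintegral_smul_measure, smul_eq_mul,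
    lintegral_add_left_eq_self (fun u => P u), Module.finrank_fintype_fun_eq_card]
  gcongr
  rw [abs_inv, abs_pow, ← inv_pow]
  gcongr
  exact inv_le_of_inv_le₀ (by norm_num) (by linarith)

/-- Poincaré inequality, in terms of pairs of points, for a density that satisfies a two-point
comparison along segments. -/
lemma lintegral_sq_sub_le {ι : Type*} [Fintype ι] {p : (ι → ℝ) → ℝ} (hpm : Measurable p)
    (hp0 : ∀ z, 0 ≤ p z) {g : (ι → ℝ) → ℝ} {D : ι → (ι → ℝ) → ℝ}
    (hDm : ∀ j, Measurable (D j)) {K : ℝ} (hK : 0 ≤ K)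
    (hp : ∀ z v, ∀ s ∈ Set.Icc (0 : ℝ) 1,
      (6 * s * (1 - s)) ^ 2 * (∑ j, v j ^ 2) * (p z * p (z + v)) ≤
        K * (p (z + smoothstep s • v) *
          (p (z + partnerLeft (smoothstep s) • v) + p (z + partnerRight (smoothstep s) • v))))
    (hg : ∀ᵐ z, ∀ᵐ v, p z ≠ 0 → p (z + v) ≠ 0 →
      ENNReal.ofReal ((g (z + v) - g z) ^ 2) ≤ ∫⁻ s in Set.Ioc (0 : ℝ) 1,
          ENNReal.ofReal ((6 * s * (1 - s) * ∑ j, v j * D j (z + smoothstep s • v)) ^ 2)) :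
    ∫⁻ z, ∫⁻ z', ENNReal.ofReal ((g z' - g z) ^ 2) *
        (ENNReal.ofReal (p z) * ENNReal.ofReal (p z')) ≤
      ENNReal.ofReal (2 * K * 6 ^ Fintype.card ι) * (∫⁻ z, ENNReal.ofReal (p z)) *
        ∫⁻ z, ENNReal.ofReal (∑ j, D j z ^ 2) * ENNReal.ofReal (p z) := by
  have hcs := continuous_smoothstep
  have hml := measurable_partnerLeft
  have hmr := measurable_partnerRight
  set P : (ι → ℝ) → ℝ≥0∞ := fun z => ENNReal.ofReal (p z) with hP
  have hPm : Measurable P := by fun_prop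
  set H : (ι → ℝ) → ℝ≥0∞ := fun z => ENNReal.ofReal (∑ j, D j z ^ 2) * P z with hH
  have hHm : Measurable H := by fun_prop
  have h1 : ∫⁻ z, ∫⁻ z', ENNReal.ofReal ((g z' - g z) ^ 2) * (P z * P z') =
      ∫⁻ z, ∫⁻ v, ENNReal.ofReal ((g (z + v) - g z) ^ 2) * (P z * P (z + v)) :=
    lintegral_congr fun z => (lintegral_add_left_eq_self
      (fun z' => ENNReal.ofReal ((g z' - g z) ^ 2) * (P z * P z')) z).symm
  set Q : ℝ → (ι → ℝ) → (ι → ℝ) → ℝ≥0∞ := fun s z v => ENNReal.ofReal K *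
    (H (z + smoothstep s • v) *
      (P (z + partnerLeft (smoothstep s) • v) + P (z + partnerRight (smoothstep s) • v))) with hQ
  have hQm : Measurable fun q : ℝ × (ι → ℝ) × (ι → ℝ) => Q q.1 q.2.1 q.2.2 := by
    have a1 : Measurable fun q : ℝ × (ι → ℝ) × (ι → ℝ) => q.2.1 + smoothstep q.1 • q.2.2 := by
      fun_prop
    have a2 : Measurable fun q : ℝ × (ι → ℝ) × (ι → ℝ) =>
        q.2.1 + partnerLeft (smoothstep q.1) • q.2.2 := by
      have := hml.comp hcs.measurable
      fun_prop
    have a3 : Measurable fun q : ℝ × (ι → ℝ) × (ι → ℝ) =>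
        q.2.1 + partnerRight (smoothstep q.1) • q.2.2 := by
      have := hmr.comp hcs.measurable
      fun_prop
    exact ((hHm.comp a1).mul ((hPm.comp a2).add (hPm.comp a3))).const_mul _
  have h2 : ∫⁻ z, ∫⁻ v, ENNReal.ofReal ((g (z + v) - g z) ^ 2) * (P z * P (z + v)) ≤
      ∫⁻ z, ∫⁻ v, ∫⁻ s in Set.Ioc (0 : ℝ) 1, Q s z v := by
    refine lintegral_mono_ae ?_
    filter_upwards [hg] with z hz
    refine lintegral_mono_ae ?_
    filter_upwards [hz] with v hv
    by_cases hz0 : p z = 0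
    · simp [hP, hz0]
    by_cases hv0 : p (z + v) = 0
    · simp [hP, hv0]
    calc ENNReal.ofReal ((g (z + v) - g z) ^ 2) * (P z * P (z + v))
        ≤ (∫⁻ s in Set.Ioc (0 : ℝ) 1, ENNReal.ofReal
            ((6 * s * (1 - s) * ∑ j, v j * D j (z + smoothstep s • v)) ^ 2)) *
            (P z * P (z + v)) := by
          gcongr; exact hv hz0 hv0
      _ = ∫⁻ s in Set.Ioc (0 : ℝ) 1, ENNReal.ofReal
            ((6 * s * (1 - s) * ∑ j, v j * D j (z + smoothstep s • v)) ^ 2) *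
            (P z * P (z + v)) :=
          (lintegral_mul_const' _ _ (by simp [hP, ENNReal.mul_eq_top])).symm
      _ ≤ _ := by
          refine setLIntegral_mono' measurableSet_Ioc fun s hs => ?_
          have hs' := Set.Ioc_subset_Icc_self hs
          simp only [hQ, hH, hP]
          rw [← ENNReal.ofReal_mul (hp0 _), ← ENNReal.ofReal_mul (sq_nonneg _),
            ← ENNReal.ofReal_mul (Finset.sum_nonneg fun j _ => sq_nonneg _),
            ← ENNReal.ofReal_add (hp0 _) (hp0 _), ← ENNReal.ofReal_mul (mul_nonneg
              (Finset.sum_nonneg fun j _ => sq_nonneg _) (hp0 _)), ← ENNReal.ofReal_mul hK]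
          refine ENNReal.ofReal_le_ofReal ?_
          have hCS := Finset.sum_mul_sq_le_sq_mul_sq Finset.univ v
            fun j => D j (z + smoothstep s • v)
          set S := ∑ j, D j (z + smoothstep s • v) ^ 2
          have hS : 0 ≤ S := Finset.sum_nonneg fun j _ => sq_nonneg _
          calc _ = (6 * s * (1 - s)) ^ 2 * (∑ j, v j * D j (z + smoothstep s • v)) ^ 2 *
                (p z * p (z + v)) := by ring
            _ ≤ (6 * s * (1 - s)) ^ 2 * ((∑ j, v j ^ 2) * S) * (p z * p (z + v)) := by
                have := mul_nonneg (hp0 z) (hp0 (z + v))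
                gcongr
            _ = S * ((6 * s * (1 - s)) ^ 2 * (∑ j, v j ^ 2) * (p z * p (z + v))) := by ring
            _ ≤ S * _ := mul_le_mul_of_nonneg_left (hp z v s hs') hS
            _ = _ := by ring
  have h3 : ∫⁻ z, ∫⁻ v, ∫⁻ s in Set.Ioc (0 : ℝ) 1, Q s z v =
      ∫⁻ s in Set.Ioc (0 : ℝ) 1, ∫⁻ v, ∫⁻ z, Q s z v := by
    calc _ = ∫⁻ z, ∫⁻ s in Set.Ioc (0 : ℝ) 1, ∫⁻ v, Q s z v := by
          refine lintegral_congr fun z => lintegral_lintegral_swap ?_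
          exact (hQm.comp (f := fun q : (ι → ℝ) × ℝ => (q.2, z, q.1)) (by fun_prop)).aemeasurable
      _ = ∫⁻ s in Set.Ioc (0 : ℝ) 1, ∫⁻ z, ∫⁻ v, Q s z v := by
          refine lintegral_lintegral_swap (Measurable.aemeasurable ?_)
          exact Measurable.lintegral_prod_right' (f := fun q : ((ι → ℝ) × ℝ) × (ι → ℝ) =>
            Q q.1.2 q.1.1 q.2) (hQm.comp
              (f := fun q : ((ι → ℝ) × ℝ) × (ι → ℝ) => (q.1.2, q.1.1, q.2)) (by fun_prop))
      _ = _ := by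
          refine lintegral_congr fun s => lintegral_lintegral_swap ?_
          exact (hQm.comp (f := fun q : (ι → ℝ) × (ι → ℝ) => (s, q.1, q.2))
            (by fun_prop)).aemeasurable
  have h4 : ∀ s ∈ Set.Ioc (0 : ℝ) 1, ∫⁻ v, ∫⁻ z, Q s z v ≤
      ENNReal.ofReal (2 * K * 6 ^ Fintype.card ι) * (∫⁻ z, P z) * ∫⁻ z, H z := fun s hs => by
    have ht := smoothstep_mem (Set.Ioc_subset_Icc_self hs)
    set t := smoothstep s with ht'
    -- Translating `z` by `t • v` puts the gradient at `z` itself; the density at the partner then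
    -- depends on `v` only through `l • v` or `r • v`, and integrating over `v` first decouples the
    -- two factors.
    set l := partnerLeft t - t with hl
    set r := partnerRight t - t with hr
    have e : ∀ v, ∫⁻ z, Q s z v = ∫⁻ z, ENNReal.ofReal K *
        (H z * (P (z + l • v) + P (z + r • v))) := fun v => by
      rw [← lintegral_add_right_eq_self (fun z => ENNReal.ofReal K *
        (H z * (P (z + l • v) + P (z + r • v)))) (t • v)]
      refine lintegral_congr fun z => ?_
      simp only [hQ, hl, hr, ← ht']
      have e1 : z + t • v + (partnerLeft t - t) • v = z + partnerLeft t • v := by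
        rw [sub_smul]; abel
      have e2 : z + t • v + (partnerRight t - t) • v = z + partnerRight t • v := by
        rw [sub_smul]; abel
      rw [e1, e2]
    simp only [e]
    rw [lintegral_lintegral_swap (by fun_prop)]
    calc ∫⁻ z, ∫⁻ v, ENNReal.ofReal K * (H z * (P (z + l • v) + P (z + r • v)))
        ≤ ∫⁻ z, (ENNReal.ofReal (2 * K * 6 ^ Fintype.card ι) * ∫⁻ z, P z) * H z := by
          refine lintegral_mono fun z => ?_
          rw [lintegral_const_mul _ (by fun_prop), lintegral_const_mul _ (by fun_prop),
            lintegral_add_left (by fun_prop)]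
          have b1 := lintegral_comp_add_smul_le hPm z (abs_partnerLeft_sub ht)
          have b2 := lintegral_comp_add_smul_le hPm z (abs_partnerRight_sub ht)
          calc _ ≤ ENNReal.ofReal K * (H z * (ENNReal.ofReal (6 ^ Fintype.card ι) * (∫⁻ z, P z) +
                ENNReal.ofReal (6 ^ Fintype.card ι) * (∫⁻ z, P z))) := by gcongr
            _ = _ := by
              rw [ENNReal.ofReal_mul (by positivity), ENNReal.ofReal_mul (by norm_num),
                ENNReal.ofReal_ofNat]
              ring
      _ = _ := lintegral_const_mul _ hHm
  rw [h1]
  refine (h2.trans_eq h3).trans ?_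
  refine (setLIntegral_mono' measurableSet_Ioc h4).trans ?_
  simp

/-! ### The orthogonal change of coordinates. -/

section Coordinates

variable {m n : ℕ} {W : Matrix (Fin m) (Fin m) ℝ}

lemma recombine_eq_mulVec (y : Act m n → ℝ) (z : Inact m n → ℝ) :
    recombine W y z = W.mulVec ((MeasurableEquiv.piEquivPiSubtypeProd (fun _ : Fin m => ℝ)
      (fun i => (i : ℕ) < n)).symm (y, z)) := by
  ext k
  simp only [recombine, Pi.add_apply, Matrix.mulVec, dotProduct, W₁, W₂, Matrix.submatrix_apply,
    id]
  rw [← Fintype.sum_subtype_add_sum_subtype (fun i : Fin m => (i : ℕ) < n)]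
  congr 1
  · refine Finset.sum_congr rfl fun i _ => ?_
    simp [MeasurableEquiv.piEquivPiSubtypeProd, Equiv.piEquivPiSubtypeProd, i.2]
  · refine Finset.sum_congr rfl fun i _ => ?_
    have := i.2
    simp only [MeasurableEquiv.piEquivPiSubtypeProd, Equiv.piEquivPiSubtypeProd]
    simp [this]

lemma recombine_add (y : Act m n → ℝ) (z v : Inact m n → ℝ) :
    recombine W y (z + v) = recombine W y z + (W₂ n W).mulVec v := by
  simp only [recombine, Matrix.mulVec_add, add_assoc]

lemma continuous_recombine :
    Continuous fun q : (Act m n → ℝ) × (Inact m n → ℝ) => recombine W q.1 q.2 := by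
  unfold recombine
  exact (continuous_const.matrix_mulVec continuous_fst).add
    (continuous_const.matrix_mulVec continuous_snd)

@[fun_prop]
lemma measurable_recombine {γ : Type*} [MeasurableSpace γ] {a : γ → Act m n → ℝ}
    {b : γ → Inact m n → ℝ} (ha : Measurable a) (hb : Measurable b) :
    Measurable fun q => recombine W (a q) (b q) :=
  continuous_recombine.measurable.comp (ha.prodMk hb)

@[fun_prop]
lemma measurable_yCoord : Measurable (yCoord n W) :=
  (continuous_const.matrix_mulVec continuous_id).measurable

lemma orthonormal_columns (hW : W ∈ Matrix.orthogonalGroup (Fin m) ℝ) (i j : Fin m) :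
    ∑ k, W k i * W k j = if i = j then 1 else 0 := by
  have h := congr_fun (congr_fun ((Matrix.mem_orthogonalGroup_iff' (Fin m) ℝ).1 hW) i) j
  simpa [Matrix.mul_apply, Matrix.star_apply, Matrix.one_apply] using h

lemma measurePreserving_recombine (hW : W ∈ Matrix.orthogonalGroup (Fin m) ℝ) :
    MeasurePreserving (fun q : (Act m n → ℝ) × (Inact m n → ℝ) => recombine W q.1 q.2)
      volume volume := by
  have hd : |W.det| = 1 := by
    have h := congr_arg Matrix.det ((Matrix.mem_orthogonalGroup_iff' (Fin m) ℝ).1 hW)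
    rw [Matrix.det_mul, Matrix.det_one, Matrix.det_transpose] at h
    rcases mul_self_eq_one_iff.1 h with h | h <;> simp [h]
  have hd0 : W.det ≠ 0 := fun h => by simp [h] at hd
  have h1 : MeasurePreserving (Matrix.toLin' W) volume volume := by
    refine ⟨(LinearMap.continuous_of_finiteDimensional _).measurable, ?_⟩
    rw [Real.map_matrix_volume_pi_eq_smul_volume_pi hd0, abs_inv, hd]
    simp
  have h2 := (volume_preserving_piEquivPiSubtypeProd (fun _ : Fin m => ℝ)
    (fun i => (i : ℕ) < n)).symm
  have h3 := h1.comp h2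
  have h4 : (fun q : (Act m n → ℝ) × (Inact m n → ℝ) => recombine W q.1 q.2) =
      Matrix.toLin' W ∘ (MeasurableEquiv.piEquivPiSubtypeProd (fun _ : Fin m => ℝ)
        (fun i => (i : ℕ) < n)).symm := by
    funext q
    exact recombine_eq_mulVec q.1 q.2
  rw [h4]
  exact h3

lemma yCoord_recombine (hW : W ∈ Matrix.orthogonalGroup (Fin m) ℝ)
    (y : Act m n → ℝ) (z : Inact m n → ℝ) :
    yCoord n W (recombine W y z) = y := by
  have h1 : (W₁ n W).transpose * W₁ n W = 1 := by
    ext i j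
    simp only [Matrix.mul_apply, Matrix.transpose_apply, W₁, Matrix.submatrix_apply, id,
      orthonormal_columns hW, Matrix.one_apply, Subtype.ext_iff]
  have h2 : (W₁ n W).transpose * W₂ n W = 0 := by
    ext i j
    have : i.1 ≠ j.1 := fun h => j.2 (h ▸ i.2)
    simp only [Matrix.mul_apply, Matrix.transpose_apply, W₁, W₂, Matrix.submatrix_apply, id,
      orthonormal_columns hW, this, if_false, Matrix.zero_apply]
  simp only [yCoord, recombine, Matrix.mulVec_add, Matrix.mulVec_mulVec, h1, h2,
    Matrix.one_mulVec, Matrix.zero_mulVec, add_zero]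

lemma transpose_inact_mul_inact (hW : W ∈ Matrix.orthogonalGroup (Fin m) ℝ) :
    (W₂ n W).transpose * W₂ n W = 1 := by
  ext i j
  simp only [Matrix.mul_apply, Matrix.transpose_apply, W₂, Matrix.submatrix_apply, id,
    orthonormal_columns hW, Matrix.one_apply, Subtype.ext_iff]

lemma zCoord_recombine (hW : W ∈ Matrix.orthogonalGroup (Fin m) ℝ)
    (y : Act m n → ℝ) (z : Inact m n → ℝ) :
    zCoord n W (recombine W y z) = z := by
  have h2 : (W₂ n W).transpose * W₁ n W = 0 := by
    ext i j
    have : i.1 ≠ j.1 := fun h => i.2 (h ▸ j.2)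
    simp only [Matrix.mul_apply, Matrix.transpose_apply, W₁, W₂, Matrix.submatrix_apply, id,
      orthonormal_columns hW, this, if_false, Matrix.zero_apply]
  simp only [zCoord, recombine, Matrix.mulVec_add, Matrix.mulVec_mulVec,
    transpose_inact_mul_inact hW, h2, Matrix.one_mulVec, Matrix.zero_mulVec, zero_add]

lemma sum_sq_inact_mulVec (hW : W ∈ Matrix.orthogonalGroup (Fin m) ℝ)
    (v : Inact m n → ℝ) :
    ∑ i, (W₂ n W).mulVec v i ^ 2 = ∑ j, v j ^ 2 := by
  have h : (W₂ n W).mulVec v ⬝ᵥ (W₂ n W).mulVec v = v ⬝ᵥ v := by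
    rw [Matrix.dotProduct_mulVec, Matrix.vecMul_mulVec, transpose_inact_mul_inact hW,
      Matrix.vecMul_one]
  simpa only [dotProduct, ← sq] using h

end Coordinates

/-! ### Marginal and conditional laws. -/

section Conditional

variable {m n : ℕ} {W : Matrix (Fin m) (Fin m) ℝ} {ρ f : (Fin m → ℝ) → ℝ}

lemma measurable_jointDensity (hρ : Measurable ρ) :
    Measurable fun q : (Act m n → ℝ) × (Inact m n → ℝ) => jointDensity ρ W q.1 q.2 :=
  (hρ.comp continuous_recombine.measurable).ennreal_ofReal

lemma measurable_jointDensity_left (hρ : Measurable ρ) (y : Act m n → ℝ) :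
    Measurable fun z : Inact m n → ℝ => jointDensity ρ W y z :=
  (measurable_jointDensity hρ).comp measurable_prodMk_left

lemma measurable_jointDensity_right (hρ : Measurable ρ) (z : Inact m n → ℝ) :
    Measurable fun y : Act m n → ℝ => jointDensity ρ W y z :=
  (measurable_jointDensity hρ).comp measurable_prodMk_right

lemma measurable_densityY (hρ : Measurable ρ) : Measurable (densityY (n := n) ρ W) :=
  (measurable_jointDensity hρ).lintegral_prod_right'

lemma measurable_densityZ (hρ : Measurable ρ) : Measurable (densityZ (n := n) ρ W) :=
  (measurable_jointDensity hρ).lintegral_prod_left'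

/-- Expectations under the input density in the coordinates `(y, z)`. -/
lemma lintegral_inputMeasure_eq (hW : W ∈ Matrix.orthogonalGroup (Fin m) ℝ) (hρ : Measurable ρ)
    {h : (Fin m → ℝ) → ℝ≥0∞} (hh : Measurable h) :
    ∫⁻ x, h x ∂(inputMeasure ρ) = ∫⁻ y : Act m n → ℝ, ∫⁻ z : Inact m n → ℝ,
      jointDensity ρ W y z * h (recombine W y z) := by
  rw [inputMeasure, lintegral_withDensity_eq_lintegral_mul _ (by fun_prop) hh,
    ← (measurePreserving_recombine (n := n) hW).lintegral_comp (by fun_prop),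
    Measure.volume_eq_prod, lintegral_prod]
  · rfl
  · have := (continuous_recombine (n := n) (W := W)).measurable
    exact (((hρ.ennreal_ofReal).mul hh).comp this).aemeasurable

lemma lintegral_condZ (hρ : Measurable ρ) (y : Act m n → ℝ) {h : (Inact m n → ℝ) → ℝ≥0∞}
    (hh : Measurable h) :
    ∫⁻ z, h z ∂(condZ ρ W y) = (densityY ρ W y)⁻¹ * ∫⁻ z, jointDensity ρ W y z * h z := by
  have hm := measurable_jointDensity_left (W := W) hρ y
  rw [condZ, lintegral_withDensity_eq_lintegral_mul _ (hm.div_const _) hh,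
    ← lintegral_const_mul _ (by fun_prop)]
  refine lintegral_congr fun z => ?_
  rw [Pi.mul_apply, div_eq_mul_inv]
  ring

lemma lintegral_condY (hρ : Measurable ρ) (z : Inact m n → ℝ) {h : (Act m n → ℝ) → ℝ≥0∞}
    (hh : Measurable h) :
    ∫⁻ y, h y ∂(condY ρ W z) = (densityZ ρ W z)⁻¹ * ∫⁻ y, jointDensity ρ W y z * h y := by
  have hm := measurable_jointDensity_right (W := W) hρ z
  rw [condY, lintegral_withDensity_eq_lintegral_mul _ (hm.div_const _) hh,
    ← lintegral_const_mul _ (by fun_prop)]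
  refine lintegral_congr fun y => ?_
  rw [Pi.mul_apply, div_eq_mul_inv]
  ring

/-- The product is `1` when the marginal is positive and finite, and `0` when it is `0` or `∞`, so
the mass never exceeds `1`. -/
lemma condZ_univ (hρ : Measurable ρ) (y : Act m n → ℝ) :
    condZ ρ W y Set.univ = (densityY ρ W y)⁻¹ * densityY ρ W y := by
  have h := lintegral_condZ (W := W) hρ y (h := fun _ => 1) measurable_const
  simpa [densityY] using h

lemma isFiniteMeasure_condZ (hρ : Measurable ρ) (y : Act m n → ℝ) :
    IsFiniteMeasure (condZ ρ W y) :=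
  ⟨by rw [condZ_univ hρ]; exact (ENNReal.inv_mul_le_one _).trans_lt ENNReal.one_lt_top⟩

lemma isProbabilityMeasure_condZ (hρ : Measurable ρ) {y : Act m n → ℝ}
    (h0 : densityY ρ W y ≠ 0) (h1 : densityY ρ W y ≠ ∞) : IsProbabilityMeasure (condZ ρ W y) :=
  ⟨by rw [condZ_univ hρ, ENNReal.inv_mul_cancel h0 h1]⟩

lemma trainLaw_univ_le_one (hρ : Measurable ρ) (N : ℕ) {P : ℕ} (d : Fin P → Act m n → ℝ) :
    trainLaw N ρ W d Set.univ ≤ 1 := by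
  have := fun y => isFiniteMeasure_condZ (W := W) hρ (y := (y : Act m n → ℝ))
  have hmc : ∀ y : Act m n → ℝ, IsFiniteMeasure (mcLaw N ρ W y) := fun y => by
    unfold mcLaw; infer_instance
  rw [trainLaw, Measure.pi_univ]
  refine Finset.prod_le_one' fun k _ => ?_
  rw [mcLaw, Measure.pi_univ]
  refine Finset.prod_le_one' fun i _ => ?_
  rw [condZ_univ hρ]
  exact ENNReal.inv_mul_le_one _

lemma measurable_condMean (hρ : Measurable ρ) (hf : Measurable f) :
    Measurable (condMean (n := n) ρ f W) := by
  have hj := measurable_jointDensity (n := n) (W := W) hρ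
  have hY := measurable_densityY (n := n) (W := W) hρ
  have hr := (continuous_recombine (n := n) (W := W)).measurable
  have h : condMean (n := n) ρ f W = fun y => ∫ z,
      (jointDensity ρ W y z / densityY ρ W y).toReal • f (recombine W y z) := by
    funext y
    have hm := measurable_jointDensity_left (W := W) hρ y
    rw [condMean, condZ, integral_withDensity_eq_integral_toReal_smul₀
      (hm.div_const _).aemeasurable]
    by_cases h0 : densityY ρ W y = 0
    -- If the marginal vanishes, so does the joint density almost everywhere, and the quotient is `0
    -- / 0 = 0`.
    · filter_upwards [(lintegral_eq_zero_iff hm).1 h0] with z hz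
      have : jointDensity ρ W y z = 0 := hz
      simp [this]
    · exact Filter.Eventually.of_forall fun z =>
        ENNReal.div_lt_top ENNReal.ofReal_ne_top h0
  rw [h]
  refine StronglyMeasurable.measurable ?_
  refine StronglyMeasurable.integral_prod_right' (f := fun q : (Act m n → ℝ) × (Inact m n → ℝ) =>
    (jointDensity ρ W q.1 q.2 / densityY ρ W q.1).toReal • f (recombine W q.1 q.2)) ?_
  refine Measurable.stronglyMeasurable ?_
  exact ((hj.div (hY.comp measurable_fst)).ennreal_toReal).smul (hf.comp hr)

end Conditional

/-! ### Variance and bias. -/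

section Variance

variable {α : Type*} [MeasurableSpace α] {ν : Measure α} [IsProbabilityMeasure ν] {g : α → ℝ}

lemma lintegral_sq_sub_integral_le (hg : Integrable g ν) :
    ∫⁻ a, ENNReal.ofReal ((g a - ∫ b, g b ∂ν) ^ 2) ∂ν ≤
      ∫⁻ a, ∫⁻ b, ENNReal.ofReal ((g b - g a) ^ 2) ∂ν ∂ν := by
  refine lintegral_mono fun a => ?_
  have h : g a - ∫ b, g b ∂ν = -∫ b, (g b - g a) ∂ν := by
    rw [integral_sub hg (integrable_const _)]
    simp
  rw [h, neg_sq]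
  exact ofReal_sq_integral_le _

/-- The cross term vanishes because `g` minus its mean integrates to zero. Applied on a slice, it
gives the orthogonal splitting of the error of any function of `y`. -/
lemma lintegral_sq_sub_const_eq (hg : MemLp g 2 ν) (c : ℝ) :
    ∫⁻ a, ENNReal.ofReal ((g a - c) ^ 2) ∂ν =
      ∫⁻ a, ENNReal.ofReal ((g a - ∫ b, g b ∂ν) ^ 2) ∂ν +
        ENNReal.ofReal ((∫ b, g b ∂ν - c) ^ 2) := by
  have hgi : Integrable g ν := hg.integrable (by norm_num)
  set G := ∫ b, g b ∂ν with hG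
  have hsq : ∀ r : ℝ, Integrable (fun a => (g a - r) ^ 2) ν := fun r =>
    (hg.sub (memLp_const r)).integrable_sq
  have h1 : ∫ a, (g a - c) ^ 2 ∂ν = ∫ a, (g a - G) ^ 2 ∂ν + (G - c) ^ 2 := by
    have e : ∀ a, (g a - c) ^ 2 = (g a - G) ^ 2 + (2 * (G - c) * (g a - G) + (G - c) ^ 2) :=
      fun a => by ring
    have hi : Integrable (fun a => 2 * (G - c) * (g a - G)) ν :=
      (hgi.sub (integrable_const _)).const_mul _
    simp only [e]
    rw [integral_add (hsq G) (by fun_prop), integral_add hi (integrable_const _),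
      integral_const_mul, integral_sub hgi (integrable_const _)]
    simp [← hG]
  rw [← ofReal_integral_eq_lintegral_ofReal (hsq c)
      (Filter.Eventually.of_forall fun a => sq_nonneg _),
    ← ofReal_integral_eq_lintegral_ofReal (hsq G)
      (Filter.Eventually.of_forall fun a => sq_nonneg _), h1,
    ENNReal.ofReal_add (integral_nonneg fun a => sq_nonneg _) (sq_nonneg _)]

end Variance

/-! ### Slices on which the conditional law is well behaved. -/

section Regular

variable {m n : ℕ} {W : Matrix (Fin m) (Fin m) ℝ} {X : Set (Fin m → ℝ)} {ρ f : (Fin m → ℝ) → ℝ}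

/-- The conditional law of `z` given `y` is a probability measure under which `f` is
square-integrable. -/
def IsRegularAt (ρ f : (Fin m → ℝ) → ℝ) (W : Matrix (Fin m) (Fin m) ℝ) (y : Act m n → ℝ) : Prop :=
  densityY ρ W y ≠ 0 ∧ densityY ρ W y ≠ ∞ ∧
    ∫⁻ z, jointDensity ρ W y z * ENNReal.ofReal (f (recombine W y z) ^ 2) ≠ ∞

lemma measurable_lintegral_jointDensity_sq (hρ : Measurable ρ) (hf : Measurable f) :
    Measurable fun y : Act m n → ℝ =>
      ∫⁻ z, jointDensity ρ W y z * ENNReal.ofReal (f (recombine W y z) ^ 2) := by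
  have hr := (continuous_recombine (n := n) (W := W)).measurable
  exact Measurable.lintegral_prod_right' (f := fun q : (Act m n → ℝ) × (Inact m n → ℝ) =>
    jointDensity ρ W q.1 q.2 * ENNReal.ofReal (f (recombine W q.1 q.2) ^ 2))
    ((measurable_jointDensity hρ).mul ((hf.comp hr).pow_const 2).ennreal_ofReal)

lemma measurableSet_isRegularAt (hρ : Measurable ρ) (hf : Measurable f) :
    MeasurableSet {y : Act m n → ℝ | IsRegularAt ρ f W y} := by
  have hY := measurable_densityY (n := n) (W := W) hρ
  exact ((hY (measurableSet_singleton 0)).compl).inter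
    (((hY (measurableSet_singleton ∞)).compl).inter
      ((measurable_lintegral_jointDensity_sq hρ hf (measurableSet_singleton ∞)).compl))

lemma lintegral_densityY (hρ : IsInputDensity X ρ) (hW : W ∈ Matrix.orthogonalGroup (Fin m) ℝ) :
    ∫⁻ y, densityY (n := n) ρ W y = 1 := by
  have := hρ.isProbabilityMeasure
  have h := lintegral_inputMeasure_eq (n := n) hW hρ.measurable (h := fun _ => 1) measurable_const
  simpa [densityY] using h.symm

lemma lintegral_densityZ (hρ : IsInputDensity X ρ) (hW : W ∈ Matrix.orthogonalGroup (Fin m) ℝ) :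
    ∫⁻ z, densityZ (n := n) ρ W z = 1 := by
  rw [← lintegral_densityY (n := n) hρ hW]
  exact lintegral_lintegral_swap
    ((measurable_jointDensity hρ.measurable).comp measurable_swap).aemeasurable

/-- The marginal and the slice integrals of `f²` both have finite integral over `y`, hence are
finite for almost every `y`. -/
lemma ae_isRegularAt (hρ : IsInputDensity X ρ) (hW : W ∈ Matrix.orthogonalGroup (Fin m) ℝ)
    (hf : Measurable f) (hf2 : MemLp f 2 (inputMeasure ρ)) :
    ∀ᵐ y : Act m n → ℝ, densityY ρ W y = 0 ∨ IsRegularAt ρ f W y := by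
  have h1 : ∀ᵐ y : Act m n → ℝ, densityY ρ W y < ∞ :=
    ae_lt_top (measurable_densityY hρ.measurable) (by rw [lintegral_densityY hρ hW]; simp)
  have h2 : ∀ᵐ y : Act m n → ℝ,
      ∫⁻ z, jointDensity ρ W y z * ENNReal.ofReal (f (recombine W y z) ^ 2) < ∞ := by
    refine ae_lt_top (measurable_lintegral_jointDensity_sq hρ.measurable hf) ?_
    rw [← lintegral_inputMeasure_eq hW hρ.measurable (h := fun x => ENNReal.ofReal (f x ^ 2))
      (by fun_prop), ← ofReal_integral_eq_lintegral_ofReal hf2.integrable_sq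
      (Filter.Eventually.of_forall fun x => sq_nonneg _)]
    exact ENNReal.ofReal_ne_top
  filter_upwards [h1, h2] with y hy1 hy2
  by_cases h0 : densityY ρ W y = 0
  · exact Or.inl h0
  · exact Or.inr ⟨h0, hy1.ne, hy2.ne⟩

lemma IsRegularAt.isProbabilityMeasure (hρ : Measurable ρ) {y : Act m n → ℝ}
    (hy : IsRegularAt ρ f W y) : IsProbabilityMeasure (condZ ρ W y) :=
  isProbabilityMeasure_condZ hρ hy.1 hy.2.1

lemma IsRegularAt.memLp (hρ : Measurable ρ) (hf : Measurable f) {y : Act m n → ℝ}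
    (hy : IsRegularAt ρ f W y) : MemLp (fun z => f (recombine W y z)) 2 (condZ ρ W y) := by
  have hm : Measurable fun z => f (recombine W y z) := by fun_prop
  rw [memLp_two_iff_integrable_sq hm.aestronglyMeasurable]
  refine ⟨(hm.pow_const 2).aestronglyMeasurable, ?_⟩
  rw [hasFiniteIntegral_iff_ofReal (Filter.Eventually.of_forall fun z => sq_nonneg _),
    lintegral_condZ hρ y (by fun_prop)]
  exact ENNReal.mul_lt_top (ENNReal.inv_lt_top.2 (pos_iff_ne_zero.2 hy.1)) hy.2.2.lt_top

lemma IsRegularAt.lintegral_jointDensity_mul (hρ : Measurable ρ) {y : Act m n → ℝ}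
    (hy : IsRegularAt ρ f W y) {h : (Inact m n → ℝ) → ℝ≥0∞} (hh : Measurable h) :
    ∫⁻ z, jointDensity ρ W y z * h z = densityY ρ W y * ∫⁻ z, h z ∂(condZ ρ W y) := by
  rw [lintegral_condZ hρ y hh, ← mul_assoc, ENNReal.mul_inv_cancel hy.1 hy.2.1, one_mul]

lemma lintegral_jointDensity_mul_eq_zero (hρ : Measurable ρ) {y : Act m n → ℝ}
    (hy : densityY ρ W y = 0) (h : (Inact m n → ℝ) → ℝ≥0∞) :
    ∫⁻ z, jointDensity ρ W y z * h z = 0 := by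
  have h0 := (lintegral_eq_zero_iff (measurable_jointDensity_left (W := W) hρ y)).1 hy
  rw [← lintegral_zero (μ := (volume : Measure (Inact m n → ℝ)))]
  refine lintegral_congr_ae ?_
  filter_upwards [h0] with z hz
  have : jointDensity ρ W y z = 0 := hz
  rw [this, zero_mul]

/-- The conditional variance of `f` given `y` in terms of pairs of points. -/
lemma IsRegularAt.lintegral_sq_sub_condMean_le (hρ : Measurable ρ) (hf : Measurable f)
    {y : Act m n → ℝ} (hy : IsRegularAt ρ f W y) :
    ∫⁻ z, jointDensity ρ W y z *
        ENNReal.ofReal ((f (recombine W y z) - condMean ρ f W y) ^ 2) ≤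
      (densityY ρ W y)⁻¹ * ∫⁻ z, ∫⁻ z',
        ENNReal.ofReal ((f (recombine W y z') - f (recombine W y z)) ^ 2) *
          (jointDensity ρ W y z * jointDensity ρ W y z') := by
  have hp := hy.isProbabilityMeasure hρ
  have hm : Measurable fun z => f (recombine W y z) := by fun_prop
  have hj := measurable_jointDensity_left (W := W) hρ y
  have hint : Integrable (fun z => f (recombine W y z)) (condZ ρ W y) :=
    (hy.memLp hρ hf).integrable (by norm_num)
  have hm2 : Measurable fun q : (Inact m n → ℝ) × (Inact m n → ℝ) => ENNReal.ofReal
      ((f (recombine W y q.2) - f (recombine W y q.1)) ^ 2) := by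
    fun_prop
  rw [hy.lintegral_jointDensity_mul hρ (by fun_prop)]
  calc densityY ρ W y *
        ∫⁻ z, ENNReal.ofReal ((f (recombine W y z) - condMean ρ f W y) ^ 2) ∂(condZ ρ W y)
      ≤ densityY ρ W y * ∫⁻ z, ∫⁻ z', ENNReal.ofReal
          ((f (recombine W y z') - f (recombine W y z)) ^ 2) ∂(condZ ρ W y) ∂(condZ ρ W y) := by
        exact mul_le_mul_right (lintegral_sq_sub_integral_le hint) _
    _ = ∫⁻ z, jointDensity ρ W y z * ∫⁻ z', ENNReal.ofReal
          ((f (recombine W y z') - f (recombine W y z)) ^ 2) ∂(condZ ρ W y) := by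
        rw [hy.lintegral_jointDensity_mul hρ]
        exact hm2.lintegral_prod_right'
    _ = ∫⁻ z, (densityY ρ W y)⁻¹ * ∫⁻ z',
        ENNReal.ofReal ((f (recombine W y z') - f (recombine W y z)) ^ 2) *
          (jointDensity ρ W y z * jointDensity ρ W y z') := by
        refine lintegral_congr fun z => ?_
        rw [lintegral_condZ hρ y (by fun_prop), ← mul_assoc, mul_comm (jointDensity ρ W y z),
          mul_assoc, ← lintegral_const_mul _ (by fun_prop)]
        congr 1
        refine lintegral_congr fun z' => ?_
        ring
    _ = _ := by
        rw [lintegral_const_mul' _ _ (ENNReal.inv_ne_top.2 hy.1)]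

lemma IsRegularAt.lintegral_sq_sub_const_eq (hρ : Measurable ρ) (hf : Measurable f)
    {y : Act m n → ℝ} (hy : IsRegularAt ρ f W y) (c : ℝ) :
    ∫⁻ z, jointDensity ρ W y z * ENNReal.ofReal ((f (recombine W y z) - c) ^ 2) =
      (∫⁻ z, jointDensity ρ W y z *
        ENNReal.ofReal ((f (recombine W y z) - condMean ρ f W y) ^ 2)) +
      densityY ρ W y * ENNReal.ofReal ((condMean ρ f W y - c) ^ 2) := by
  have hp := hy.isProbabilityMeasure hρ
  have hm : Measurable fun z => f (recombine W y z) := by fun_prop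
  rw [hy.lintegral_jointDensity_mul hρ (by fun_prop),
    hy.lintegral_jointDensity_mul hρ (by fun_prop),
    ActiveSubspace.lintegral_sq_sub_const_eq (hy.memLp hρ hf) c, mul_add]
  rfl

/-- The Monte Carlo estimate is at least as far from a constant as the conditional mean. -/
lemma IsRegularAt.sq_condMean_sub_le (hρ : Measurable ρ) (hf : Measurable f)
    {y : Act m n → ℝ} (hy : IsRegularAt ρ f W y) {N : ℕ} (hN : 0 < N) (c : ℝ) :
    ENNReal.ofReal ((condMean ρ f W y - c) ^ 2) ≤
      ∫⁻ zs, ENNReal.ofReal ((mcEstimate f W y zs - c) ^ 2) ∂(mcLaw N ρ W y) := by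
  have hp := hy.isProbabilityMeasure hρ
  have hint : Integrable (fun z => f (recombine W y z)) (condZ ρ W y) :=
    (hy.memLp hρ hf).integrable (by norm_num)
  have hpm : IsProbabilityMeasure (mcLaw N ρ W y) := by unfold mcLaw; infer_instance
  have hi : ∀ i : Fin N, Integrable (fun zs : Fin N → Inact m n → ℝ => f (recombine W y (zs i)))
      (mcLaw N ρ W y) := fun i =>
    (measurePreserving_eval (fun _ : Fin N => condZ ρ W y) i).integrable_comp_of_integrable hint
  have hmean : ∫ zs, (mcEstimate f W y zs - c) ∂(mcLaw N ρ W y) = condMean ρ f W y - c := by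
    have hint' : Integrable (fun zs => mcEstimate f W y zs) (mcLaw N ρ W y) :=
      (integrable_finsetSum _ fun i _ => hi i).const_mul _
    rw [integral_sub hint' (integrable_const _)]
    congr 1
    · simp only [mcEstimate]
      rw [integral_const_mul, integral_finsetSum _ fun i _ => hi i]
      have : ∀ i : Fin N, ∫ zs, f (recombine W y (zs i)) ∂(mcLaw N ρ W y) = condMean ρ f W y :=
        fun i => integral_comp_eval (μ := fun _ : Fin N => condZ ρ W y)
          (f := fun z => f (recombine W y z)) hint.aestronglyMeasurable
      simp only [this]
      have hN' : (N : ℝ) ≠ 0 := by exact_mod_cast hN.ne'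
      simp [hN']
    · simp
  rw [← hmean]
  exact ofReal_sq_integral_le _

end Regular

/-! ### The error of the conditional mean. -/

section Bounds

variable {m n : ℕ} {W : Matrix (Fin m) (Fin m) ℝ} {X : Set (Fin m → ℝ)} {ρ f : (Fin m → ℝ) → ℝ}

lemma sum_inact_mulVec_mul (v : Inact m n → ℝ) (D : Fin m → ℝ) :
    ∑ i, (W₂ n W).mulVec v i * D i = ∑ j : Inact m n, v j * ∑ i, W i j * D i := by
  simp only [Matrix.mulVec, dotProduct, W₂, Matrix.submatrix_apply, id, Finset.sum_mul,
    Finset.mul_sum]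
  rw [Finset.sum_comm]
  exact Finset.sum_congr rfl fun j _ => Finset.sum_congr rfl fun i _ => by ring

/-- Poincaré inequality on almost every slice of fixed `y`. -/
lemma ae_lintegral_slice_le (hρ : IsInputDensity X ρ)
    (hW : W ∈ Matrix.orthogonalGroup (Fin m) ℝ) (hf : Measurable f) {K : ℝ} (hK : 0 ≤ K)
    (hseg : ∀ (x v : Fin m → ℝ), ∀ s ∈ Set.Icc (0 : ℝ) 1,
      (6 * s * (1 - s)) ^ 2 * (∑ i, v i ^ 2) * (ρ x * ρ (x + v)) ≤
        K * (ρ (x + smoothstep s • v) *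
          (ρ (x + partnerLeft (smoothstep s) • v) + ρ (x + partnerRight (smoothstep s) • v))))
    {D : Fin m → (Fin m → ℝ) → ℝ} (hDm : ∀ i, Measurable (D i))
    (hD : ∀ v, ∀ᵐ x, x ∈ X → x + v ∈ X →
      ENNReal.ofReal ((f (x + v) - f x) ^ 2) ≤ ∫⁻ s in Set.Ioc (0 : ℝ) 1,
        ENNReal.ofReal ((6 * s * (1 - s) * ∑ i, v i * D i (x + smoothstep s • v)) ^ 2)) :
    ∀ᵐ y : Act m n → ℝ,
      ∫⁻ z, ∫⁻ z', ENNReal.ofReal ((f (recombine W y z') - f (recombine W y z)) ^ 2) *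
          (jointDensity ρ W y z * jointDensity ρ W y z') ≤
        ENNReal.ofReal (2 * K * 6 ^ m) * densityY ρ W y *
          ∫⁻ z, ENNReal.ofReal (∑ j : Inact m n, (∑ i, W i j * D i (recombine W y z)) ^ 2) *
            jointDensity ρ W y z := by
  have hρm := hρ.measurable
  have hcs := continuous_smoothstep
  set bound : (Act m n → ℝ) → (Inact m n → ℝ) → (Inact m n → ℝ) → Prop := fun y z v =>
    ρ (recombine W y z) ≠ 0 → ρ (recombine W y (z + v)) ≠ 0 →
      ENNReal.ofReal ((f (recombine W y (z + v)) - f (recombine W y z)) ^ 2) ≤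
        ∫⁻ s in Set.Ioc (0 : ℝ) 1, ENNReal.ofReal ((6 * s * (1 - s) *
          ∑ j : Inact m n, v j * ∑ i, W i j * D i (recombine W y (z + smoothstep s • v))) ^ 2)
    with hbound
  have hall : ∀ v : Inact m n → ℝ, ∀ᵐ q : (Act m n → ℝ) × (Inact m n → ℝ), bound q.1 q.2 v :=
    fun v => by
    filter_upwards [(measurePreserving_recombine hW).quasiMeasurePreserving.ae
      (hD ((W₂ n W).mulVec v))] with q hq h1 h2
    simp only [recombine_add, Matrix.mulVec_smul, ← sum_inact_mulVec_mul] at h2 ⊢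
    exact hq (hρ.mem_of_ne_zero h1) (hρ.mem_of_ne_zero h2)
  have hmeas : MeasurableSet {r : (Inact m n → ℝ) × ((Act m n → ℝ) × (Inact m n → ℝ)) |
      bound r.2.1 r.2.2 r.1} := by
    have m1 : MeasurableSet {r : (Inact m n → ℝ) × ((Act m n → ℝ) × (Inact m n → ℝ)) |
        ρ (recombine W r.2.1 r.2.2) ≠ 0} :=
      (measurableSet_singleton (0 : ℝ)).compl.preimage (by fun_prop)
    have m2 : MeasurableSet {r : (Inact m n → ℝ) × ((Act m n → ℝ) × (Inact m n → ℝ)) |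
        ρ (recombine W r.2.1 (r.2.2 + r.1)) ≠ 0} :=
      (measurableSet_singleton (0 : ℝ)).compl.preimage (by fun_prop)
    have m3 : MeasurableSet {r : (Inact m n → ℝ) × ((Act m n → ℝ) × (Inact m n → ℝ)) |
        ENNReal.ofReal ((f (recombine W r.2.1 (r.2.2 + r.1)) - f (recombine W r.2.1 r.2.2)) ^ 2) ≤
        ∫⁻ s in Set.Ioc (0 : ℝ) 1, ENNReal.ofReal ((6 * s * (1 - s) * ∑ j : Inact m n,
          r.1 j * ∑ i, W i j * D i (recombine W r.2.1 (r.2.2 + smoothstep s • r.1))) ^ 2)} := by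
      refine measurableSet_le (by fun_prop) ?_
      refine Measurable.lintegral_prod_right' (f := fun q :
        ((Inact m n → ℝ) × ((Act m n → ℝ) × (Inact m n → ℝ))) × ℝ =>
          ENNReal.ofReal ((6 * q.2 * (1 - q.2) * ∑ j : Inact m n,
            q.1.1 j * ∑ i, W i j * D i (recombine W q.1.2.1
              (q.1.2.2 + smoothstep q.2 • q.1.1))) ^ 2)) ?_
      fun_prop
    convert (m1.compl.union (m2.compl.union m3)) using 1
    ext r
    simp only [hbound, Set.mem_ofPred_eq, Set.mem_union, Set.mem_compl_iff]
    tauto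
  -- The null set of base points depends on `v`. Joint measurability of `bound` lets the quantifiers
  -- be exchanged, so almost every slice satisfies the increment bound for almost all pairs.
  have hae : ∀ᵐ q : (Act m n → ℝ) × (Inact m n → ℝ), ∀ᵐ v : Inact m n → ℝ, bound q.1 q.2 v :=
    (Measure.ae_ae_comm hmeas).1 (Filter.Eventually.of_forall hall)
  rw [Measure.volume_eq_prod] at hae
  filter_upwards [Measure.ae_ae_of_ae_prod hae] with y hy
  -- The columns of `W₂` are orthonormal, so a slice inherits the two-point comparison with the same
  -- `K`.
  have h := lintegral_sq_sub_le (p := fun z => ρ (recombine W y z)) (by fun_prop)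
    (fun z => hρ.nonneg _) (g := fun z => f (recombine W y z))
    (D := fun j z => ∑ i, W i j * D i (recombine W y z)) (by fun_prop) hK
    (fun z v s hs => by
      simp only [recombine_add, Matrix.mulVec_smul, ← sum_sq_inact_mulVec hW v]
      exact hseg _ _ s hs) hy
  refine h.trans ?_
  have hcard : Fintype.card (Inact m n) ≤ m := by
    simpa only [Fintype.card_fin] using Fintype.card_subtype_le fun i : Fin m => ¬ (i : ℕ) < n
  have hc : ENNReal.ofReal (2 * K * 6 ^ Fintype.card (Inact m n)) ≤
      ENNReal.ofReal (2 * K * 6 ^ m) := by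
    gcongr
    norm_num
  exact mul_le_mul_left (mul_le_mul_left hc _) _

/-- The squared derivative of `f` along the `j`-th column of `W` has mean `(Wᵀ C W)ⱼⱼ`, which the
diagonalisation identifies with `eig j`. -/
lemma lintegral_sum_sq_eq (hW : W ∈ Matrix.orthogonalGroup (Fin m) ℝ)
    (hd : ∀ i, MemLp (pderiv f i) 2 (inputMeasure ρ)) {eig : Fin m → ℝ}
    (hC : gradCov ρ f = W * Matrix.diagonal eig * W.transpose)
    {D : Fin m → (Fin m → ℝ) → ℝ} (hD : ∀ i, D i =ᵐ[inputMeasure ρ] pderiv f i) :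
    0 ≤ ∑ j : Inact m n, eig j ∧
    ∫⁻ x, ENNReal.ofReal (∑ j : Inact m n, (∑ i, W i j * D i x) ^ 2) ∂(inputMeasure ρ) =
      ENNReal.ofReal (∑ j : Inact m n, eig j) := by
  have hprod : ∀ i k, Integrable (fun x => pderiv f i x * pderiv f k x) (inputMeasure ρ) :=
    fun i k => (hd i).integrable_mul (hd k)
  have hsq : ∀ (j : Fin m) x, (∑ i, W i j * pderiv f i x) ^ 2 =
      ∑ i, ∑ k, W i j * W k j * (pderiv f i x * pderiv f k x) := fun j x => by
    rw [sq, Finset.sum_mul_sum]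
    exact Finset.sum_congr rfl fun i _ => Finset.sum_congr rfl fun k _ => by ring
  have hint : ∀ j : Fin m, Integrable (fun x => (∑ i, W i j * pderiv f i x) ^ 2)
      (inputMeasure ρ) := fun j => by
    simp only [hsq]
    exact integrable_finsetSum _ fun i _ => integrable_finsetSum _ fun k _ =>
      (hprod i k).const_mul _
  have heig : ∀ j : Fin m, ∫ x, (∑ i, W i j * pderiv f i x) ^ 2 ∂(inputMeasure ρ) = eig j :=
    fun j => by
    have h1 : ∫ x, (∑ i, W i j * pderiv f i x) ^ 2 ∂(inputMeasure ρ) =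
        (W.transpose * gradCov ρ f * W) j j := by
      simp only [hsq]
      rw [integral_finsetSum _ fun i _ => integrable_finsetSum _ fun k _ =>
        (hprod i k).const_mul _]
      simp only [Matrix.mul_apply, Matrix.transpose_apply, gradCov, Matrix.of_apply,
        Finset.sum_mul]
      rw [Finset.sum_comm]
      refine Finset.sum_congr rfl fun i _ => ?_
      rw [integral_finsetSum _ fun k _ => (hprod i k).const_mul _]
      refine Finset.sum_congr rfl fun k _ => ?_
      rw [integral_const_mul]
      ring
    have hWW : W.transpose * W = 1 := by
      simpa using (Matrix.mem_orthogonalGroup_iff' (Fin m) ℝ).1 hW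
    rw [h1, hC]
    have h2 : W.transpose * (W * Matrix.diagonal eig * W.transpose) * W =
        (W.transpose * W) * Matrix.diagonal eig * (W.transpose * W) := by
      simp only [Matrix.mul_assoc]
    rw [h2, hWW, one_mul, mul_one, Matrix.diagonal_apply_eq]
  have hnn : 0 ≤ ∑ j : Inact m n, eig j := Finset.sum_nonneg fun j _ => by
    rw [← heig j]
    exact integral_nonneg fun x => sq_nonneg _
  refine ⟨hnn, ?_⟩
  have hae : (fun x => ENNReal.ofReal (∑ j : Inact m n, (∑ i, W i j * D i x) ^ 2))
      =ᵐ[inputMeasure ρ]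
        fun x => ENNReal.ofReal (∑ j : Inact m n, (∑ i, W i j * pderiv f i x) ^ 2) := by
    filter_upwards [ae_all_iff.2 hD] with x hx
    simp only [hx]
  have hint' : Integrable (fun x => ∑ j : Inact m n, (∑ i, W i j * pderiv f i x) ^ 2)
      (inputMeasure ρ) := integrable_finsetSum _ fun j _ => hint j
  rw [lintegral_congr_ae hae, ← ofReal_integral_eq_lintegral_ofReal hint'
    (Filter.Eventually.of_forall fun x => Finset.sum_nonneg fun j _ => sq_nonneg _),
    integral_finsetSum _ fun (j : Inact m n) _ => hint j]
  simp only [heig]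

lemma mseCondMean_eq (hρ : Measurable ρ) (hW : W ∈ Matrix.orthogonalGroup (Fin m) ℝ)
    (hf : Measurable f) :
    mseCondMean n ρ f W = ∫⁻ y : Act m n → ℝ, ∫⁻ z, jointDensity ρ W y z *
      ENNReal.ofReal ((f (recombine W y z) - condMean ρ f W y) ^ 2) := by
  have hG := measurable_condMean (n := n) (W := W) hρ hf
  rw [mseCondMean, lintegral_inputMeasure_eq (n := n) hW hρ (by fun_prop)]
  simp only [yCoord_recombine hW]

/-- The mean square error of the conditional mean is bounded by the mean square of the gradient
in the inactive directions. -/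
lemma mseCondMean_le (hρ : IsInputDensity X ρ)
    (hW : W ∈ Matrix.orthogonalGroup (Fin m) ℝ) (hf : Measurable f)
    (hf2 : MemLp f 2 (inputMeasure ρ)) {K : ℝ} (hK : 0 ≤ K)
    (hseg : ∀ (x v : Fin m → ℝ), ∀ s ∈ Set.Icc (0 : ℝ) 1,
      (6 * s * (1 - s)) ^ 2 * (∑ i, v i ^ 2) * (ρ x * ρ (x + v)) ≤
        K * (ρ (x + smoothstep s • v) *
          (ρ (x + partnerLeft (smoothstep s) • v) + ρ (x + partnerRight (smoothstep s) • v))))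
    {D : Fin m → (Fin m → ℝ) → ℝ} (hDm : ∀ i, Measurable (D i))
    (hD : ∀ v, ∀ᵐ x, x ∈ X → x + v ∈ X →
      ENNReal.ofReal ((f (x + v) - f x) ^ 2) ≤ ∫⁻ s in Set.Ioc (0 : ℝ) 1,
        ENNReal.ofReal ((6 * s * (1 - s) * ∑ i, v i * D i (x + smoothstep s • v)) ^ 2)) :
    mseCondMean n ρ f W ≤ ENNReal.ofReal (2 * K * 6 ^ m) *
      ∫⁻ x, ENNReal.ofReal (∑ j : Inact m n, (∑ i, W i j * D i x) ^ 2) ∂(inputMeasure ρ) := by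
  have hρm := hρ.measurable
  have hj := measurable_jointDensity (n := n) (W := W) hρm
  rw [mseCondMean_eq hρm hW hf, lintegral_inputMeasure_eq (n := n) hW hρm (by fun_prop),
    ← lintegral_const_mul]
  · refine lintegral_mono_ae ?_
    filter_upwards [ae_isRegularAt hρ hW hf hf2,
      ae_lintegral_slice_le (n := n) hρ hW hf hK hseg hDm hD] with y hy hs
    rcases hy with hy | hy
    · rw [lintegral_jointDensity_mul_eq_zero hρm hy]
      exact zero_le
    · refine (hy.lintegral_sq_sub_condMean_le hρm hf).trans ?_
      refine (mul_le_mul_right hs _).trans_eq ?_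
      -- The marginal in the slice inequality cancels against the normalisation of the conditional
      -- law, so the constant is uniform in `y`.
      have e : ∀ a b c : ℝ≥0∞, b⁻¹ * (a * b * c) = b⁻¹ * b * (a * c) := fun a b c => by ring
      rw [e, ENNReal.inv_mul_cancel hy.1 hy.2.1, one_mul]
      simp only [mul_comm (jointDensity ρ W y _)]
  · refine Measurable.lintegral_prod_right' (f := fun q : (Act m n → ℝ) × (Inact m n → ℝ) =>
      jointDensity ρ W q.1 q.2 *
        ENNReal.ofReal (∑ j : Inact m n, (∑ i, W i j * D i (recombine W q.1 q.2)) ^ 2)) ?_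
    exact hj.mul (by fun_prop)

end Bounds

/-! ### The error of the response surface. -/

section ResponseSurface

variable {m n N P : ℕ} {W : Matrix (Fin m) (Fin m) ℝ} {X : Set (Fin m → ℝ)}
  {ρ f : (Fin m → ℝ) → ℝ} {d : Fin P → Act m n → ℝ} {R : (Act m n → ℝ) → (Fin P → ℝ) → ℝ}

lemma measurable_respSurf (hf : Measurable f) (hR : Measurable (Function.uncurry R)) :
    Measurable fun q : (Fin P → Fin N → Inact m n → ℝ) × (Act m n → ℝ) =>
      respSurf f W d R q.1 q.2 := by
  have h : Measurable fun q : (Fin P → Fin N → Inact m n → ℝ) × (Act m n → ℝ) =>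
      (q.2, fun k => mcEstimate f W (d k) (q.1 k)) := by
    unfold mcEstimate
    fun_prop
  exact hR.comp h

lemma sfinite_trainLaw (hρ : Measurable ρ) : SFinite (trainLaw N ρ W d) := by
  have := fun y => isFiniteMeasure_condZ (W := W) hρ (y := (y : Act m n → ℝ))
  have hmc : ∀ y : Act m n → ℝ, IsFiniteMeasure (mcLaw N ρ W y) := fun y => by
    unfold mcLaw; infer_instance
  unfold trainLaw
  infer_instance

/-- The mean square distance between the conditional mean and the response surface. -/
lemma lintegral_sq_condMean_sub_respSurf_le (hρ : IsInputDensity X ρ)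
    (hW : W ∈ Matrix.orthogonalGroup (Fin m) ℝ) (hf : Measurable f)
    (hf2 : MemLp f 2 (inputMeasure ρ)) (hN : 0 < N) (hR : Measurable (Function.uncurry R))
    {c : ℝ≥0∞} (hc : ∀ z ∈ zCoord n W '' X, condErrRespSurf N ρ f W d R z ≤ c) :
    ∫⁻ y, densityY ρ W y * ∫⁻ ζ, ENNReal.ofReal ((condMean ρ f W y - respSurf f W d R ζ y) ^ 2)
      ∂(trainLaw N ρ W d) ≤ c := by
  have hρm := hρ.measurable
  have hsf := sfinite_trainLaw (N := N) (W := W) (d := d) hρm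
  have hG := measurable_condMean (n := n) (W := W) hρm hf
  have hj := measurable_jointDensity (n := n) (W := W) hρm
  set h : (Act m n → ℝ) → ℝ≥0∞ := fun y =>
    ∫⁻ ζ, ENNReal.ofReal ((condMean ρ f W y - respSurf f W d R ζ y) ^ 2) ∂(trainLaw N ρ W d)
    with hh
  have hhm : Measurable h := by
    refine Measurable.lintegral_prod_right' (f := fun q : (Act m n → ℝ) ×
      (Fin P → Fin N → Inact m n → ℝ) =>
        ENNReal.ofReal ((condMean ρ f W q.1 - respSurf f W d R q.2 q.1) ^ 2)) ?_
    have h1 : Measurable fun q : (Act m n → ℝ) × (Fin P → Fin N → Inact m n → ℝ) =>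
        respSurf f W d R q.2 q.1 :=
      (measurable_respSurf (N := N) (W := W) (d := d) hf hR).comp measurable_swap
    exact ((((hG.comp measurable_fst).sub h1)).pow_const 2).ennreal_ofReal
  -- Restricting the measurable `h` to regular points gives a function below the Monte Carlo error
  -- at every `y`. Tonelli is applied to this minorant, and monotonicity then needs no measurability
  -- in `y` of the Monte Carlo integral.
  set A : Set (Act m n → ℝ) := {y | IsRegularAt ρ f W y}
  have hA : MeasurableSet A := measurableSet_isRegularAt hρm hf
  have hkm : Measurable (A.indicator h) := hhm.indicator hA
  have hle : ∀ y, A.indicator h y ≤ ∫⁻ ζ, ∫⁻ zs,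
      ENNReal.ofReal ((mcEstimate f W y zs - respSurf f W d R ζ y) ^ 2) ∂(mcLaw N ρ W y)
        ∂(trainLaw N ρ W d) := fun y => by
    refine Set.indicator_apply_le' (fun hy => ?_) fun _ => zero_le
    exact lintegral_mono fun ζ => IsRegularAt.sq_condMean_sub_le hρm hf hy hN _
  calc ∫⁻ y, densityY ρ W y * h y = ∫⁻ y, densityY ρ W y * A.indicator h y := by
        refine lintegral_congr_ae ?_
        filter_upwards [ae_isRegularAt hρ hW hf hf2] with y hy
        rcases hy with hy | hy
        · rw [hy, zero_mul, zero_mul]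
        · rw [Set.indicator_of_mem (show y ∈ A from hy)]
    _ = ∫⁻ y, ∫⁻ z, jointDensity ρ W y z * A.indicator h y := by
        refine lintegral_congr fun y => ?_
        rw [lintegral_mul_const _ (measurable_jointDensity_left hρm y)]
        rfl
    _ = ∫⁻ z, ∫⁻ y, jointDensity ρ W y z * A.indicator h y :=
        lintegral_lintegral_swap (hj.mul (hkm.comp measurable_fst)).aemeasurable
    _ ≤ ∫⁻ z, densityZ (n := n) ρ W z * c := by
        have hfin : ∀ᵐ z : Inact m n → ℝ, densityZ ρ W z < ∞ :=
          ae_lt_top (measurable_densityZ hρm) (by rw [lintegral_densityZ hρ hW]; simp)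
        refine lintegral_mono_ae ?_
        filter_upwards [hfin] with z hz
        have hjz := measurable_jointDensity_right (W := W) hρm z
        by_cases h0 : densityZ ρ W z = 0
        · have h1 : ∫⁻ y, jointDensity ρ W y z * A.indicator h y = 0 := by
            rw [← lintegral_zero (μ := (volume : Measure (Act m n → ℝ)))]
            refine lintegral_congr_ae ?_
            filter_upwards [(lintegral_eq_zero_iff hjz).1 h0] with y hy
            have : jointDensity ρ W y z = 0 := hy
            rw [this, zero_mul]
          rw [h1]
          exact zero_le
        · obtain ⟨y, hy⟩ : ∃ y : Act m n → ℝ, jointDensity ρ W y z ≠ 0 := by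
            by_contra hcon
            push Not at hcon
            exact h0 (by simp [densityZ, hcon])
          -- A fibre that carries density meets `X`, so the hypothesis is available at this `z`.
          have hzm : z ∈ zCoord n W '' X := by
            refine ⟨recombine W y z, hρ.mem_of_ne_zero fun h => hy ?_, zCoord_recombine hW y z⟩
            simp [jointDensity, h]
          have h1 : ∫⁻ y, jointDensity ρ W y z * A.indicator h y =
              densityZ ρ W z * ∫⁻ y, A.indicator h y ∂(condY ρ W z) := by
            rw [lintegral_condY hρm z hkm, ← mul_assoc, ENNReal.mul_inv_cancel h0 hz.ne, one_mul]
          rw [h1]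
          exact mul_le_mul_right ((lintegral_mono hle).trans (hc z hzm)) _
    _ = c := by
        rw [lintegral_mul_const _ (measurable_densityZ hρm), lintegral_densityZ hρ hW, one_mul]

/-- The error of the response surface splits at the conditional mean. -/
lemma mseRespSurf_le (hρ : IsInputDensity X ρ)
    (hW : W ∈ Matrix.orthogonalGroup (Fin m) ℝ) (hf : Measurable f)
    (hf2 : MemLp f 2 (inputMeasure ρ)) (hN : 0 < N) (hR : Measurable (Function.uncurry R))
    {c : ℝ≥0∞} (hc : ∀ z ∈ zCoord n W '' X, condErrRespSurf N ρ f W d R z ≤ c) :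
    mseRespSurf N ρ f W d R ≤ mseCondMean n ρ f W + c := by
  have hρm := hρ.measurable
  have hsf := sfinite_trainLaw (N := N) (W := W) (d := d) hρm
  have hG := measurable_condMean (n := n) (W := W) hρm hf
  have hY := measurable_densityY (n := n) (W := W) hρm
  have hj := measurable_jointDensity (n := n) (W := W) hρm
  have hS := measurable_respSurf (N := N) (W := W) (d := d) hf hR
  have hinner : ∀ ζ : Fin P → Fin N → Inact m n → ℝ,
      ∫⁻ x, ENNReal.ofReal ((f x - respSurf f W d R ζ (yCoord n W x)) ^ 2) ∂(inputMeasure ρ) ≤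
        mseCondMean n ρ f W + ∫⁻ y, densityY ρ W y *
          ENNReal.ofReal ((condMean ρ f W y - respSurf f W d R ζ y) ^ 2) := fun ζ => by
    have hSζ : Measurable fun y => respSurf f W d R ζ y := hS.comp measurable_prodMk_left
    rw [lintegral_inputMeasure_eq (n := n) hW hρm (by fun_prop), mseCondMean_eq hρm hW hf,
      ← lintegral_add_right _ (by fun_prop)]
    refine lintegral_mono_ae ?_
    filter_upwards [ae_isRegularAt hρ hW hf hf2] with y hy
    simp only [yCoord_recombine hW]
    rcases hy with hy | hy
    · rw [lintegral_jointDensity_mul_eq_zero hρm hy]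
      exact zero_le
    · exact (hy.lintegral_sq_sub_const_eq hρm hf _).le
  calc mseRespSurf N ρ f W d R
      ≤ ∫⁻ ζ, (mseCondMean n ρ f W + ∫⁻ y, densityY ρ W y *
          ENNReal.ofReal ((condMean ρ f W y - respSurf f W d R ζ y) ^ 2))
            ∂(trainLaw N ρ W d) := lintegral_mono hinner
    _ = mseCondMean n ρ f W * trainLaw N ρ W d Set.univ + ∫⁻ ζ, (∫⁻ y, densityY ρ W y *
          ENNReal.ofReal ((condMean ρ f W y - respSurf f W d R ζ y) ^ 2))
            ∂(trainLaw N ρ W d) := by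
        rw [lintegral_add_left measurable_const, lintegral_const]
    _ ≤ mseCondMean n ρ f W + c := by
        refine add_le_add ?_ ?_
        · exact (mul_le_mul_right (trainLaw_univ_le_one hρm N d) _).trans_eq (mul_one _)
        · rw [lintegral_lintegral_swap]
          · refine le_trans (le_of_eq ?_)
              (lintegral_sq_condMean_sub_respSurf_le hρ hW hf hf2 hN hR hc)
            refine lintegral_congr fun y => ?_
            have hSy : Measurable fun ζ => respSurf f W d R ζ y := hS.comp measurable_prodMk_right
            rw [lintegral_const_mul _ (by fun_prop)]
          · refine Measurable.aemeasurable ?_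
            exact (hY.comp measurable_snd).mul
              ((((hG.comp measurable_snd).sub hS)).pow_const 2).ennreal_ofReal

end ResponseSurface

end ActiveSubspace

end

/-! ### Assembly of the two bounds. -/

theorem mainTheorem4 {m : ℕ} (X : Set (Fin m → ℝ)) (ρ : (Fin m → ℝ) → ℝ)
    (hρ : ActiveSubspace.IsInputDensity X ρ)
    (hXρ : ActiveSubspace.StronglyLogConcaveType X ρ) :
    ∃ C₁ : ℝ, 0 ≤ C₁ ∧
      ∀ (n : ℕ), 0 < n → n < m →
      ∀ (f : (Fin m → ℝ) → ℝ), Measurable f →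
        ActiveSubspace.AbsContOn X f →
        MemLp f 2 (ActiveSubspace.inputMeasure ρ) →
        (∀ i, MemLp (ActiveSubspace.pderiv f i) 2 (ActiveSubspace.inputMeasure ρ)) →
      ∀ (W : Matrix (Fin m) (Fin m) ℝ) (eig : Fin m → ℝ),
        W ∈ Matrix.orthogonalGroup (Fin m) ℝ →
        Antitone eig →
        ActiveSubspace.gradCov ρ f = W * Matrix.diagonal eig * W.transpose →
        ActiveSubspace.mseCondMean n ρ f W
            ≤ ENNReal.ofReal (C₁ * ∑ j : ActiveSubspace.Inact m n, eig j) ∧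
        ∀ (N P : ℕ), 0 < N →
        ∀ (d : Fin P → ActiveSubspace.Act m n → ℝ),
          (∀ k, d k ∈ ActiveSubspace.yCoord n W '' X) →
          (∀ k, 0 < ActiveSubspace.densityY ρ W (d k)) →
        ∀ (R : (ActiveSubspace.Act m n → ℝ) → (Fin P → ℝ) → ℝ),
          Measurable (Function.uncurry R) →
        ∀ (C₂ δ : ℝ), 0 ≤ C₂ → 0 ≤ δ →
          (∀ z ∈ ActiveSubspace.zCoord n W '' X,
            ActiveSubspace.condErrRespSurf N ρ f W d R z ≤ ENNReal.ofReal (C₂ * δ)) →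
          ActiveSubspace.mseRespSurf N ρ f W d R
            ≤ ENNReal.ofReal
                (C₁ * (1 + 1 / (N : ℝ)) * (∑ j : ActiveSubspace.Inact m n, eig j) + C₂ * δ) := by
  obtain ⟨K, hK, hseg⟩ := ActiveSubspace.exists_density_endpoints_le hρ hXρ
  -- `2` counts the two partners, `K` is the constant of the density comparison, and `6 ^ m` bounds
  -- the Jacobian for slices of any dimension up to `m`.
  refine ⟨2 * K * 6 ^ m, by positivity, ?_⟩
  intro n _ _ f hf hac hf2 hd W eig hW _ hC
  obtain ⟨D, hDm, hDe, hD⟩ := ActiveSubspace.exists_measurable_gradient hρ hXρ hac hf2 hd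
  obtain ⟨hnn, hsum⟩ := ActiveSubspace.lintegral_sum_sq_eq (n := n) hW hd hC hDe
  have hmain : ActiveSubspace.mseCondMean n ρ f W
      ≤ ENNReal.ofReal (2 * K * 6 ^ m * ∑ j : ActiveSubspace.Inact m n, eig j) := by
    rw [ENNReal.ofReal_mul (by positivity), ← hsum]
    exact ActiveSubspace.mseCondMean_le hρ hW hf hf2 hK hseg hDm hD
  refine ⟨hmain, ?_⟩
  intro N P hN d _ _ R hR C₂ δ hC₂ hδ hc
  refine (ActiveSubspace.mseRespSurf_le hρ hW hf hf2 hN hR hc).trans ?_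
  have hN' : (0 : ℝ) ≤ 1 / N := by positivity
  have hC₁ : 0 ≤ 2 * K * 6 ^ m * ∑ j : ActiveSubspace.Inact m n, eig j := by positivity
  rw [ENNReal.ofReal_add (by positivity) (by positivity)]
  gcongr
  refine hmain.trans (ENNReal.ofReal_le_ofReal ?_)
  -- The bound already holds with factor `1`; the term in `1/N` only adds a nonnegative amount.
  nlinarith [mul_nonneg hC₁ hN']
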